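/- Let $f,g_1,\dots,g_m\in\mathbb{R}[\mathbf{x}]=\mathbb{R}[x_1,\dots,x_n]$ and $K=\{\mathbf{x}\in\mathbb{R}^n : g_j(\mathbf{x})\ge 0,\ j=1,\dots,m\}$, and assume that $f$ is bounded below on $K$. For a polynomial $q$ let $\tilde q(x_0,\mathbf{x})=x_0^{\deg q}\,q(\mathbf{x}/x_0)$ be its homogenization (with $\deg 0:=0$), and write $\tilde{\mathbf{x}}=(x_0,\mathbf{x})$. Let $$\widetilde K=\{\tilde{\mathbf{x}}\in\mathbb{R}^{n+1} : \tilde g_j(\tilde{\mathbf{x}})\ge 0\ (j=1,\dots,m),\ x_0\ge 0,\ \|\tilde{\mathbf{x}}\|^2=1\}.$$ Suppose that $K$ is closed at infinity, that is, $\widetilde K$ is the closure of $\widetilde K\cap\{x_0>0\}$. Suppose that the problem $\inf\{f(\mathbf{x}) : \mathbf{x}\in K\}$ has a correlative sparsity pattern $(\mathbf{x}(1),\dots,\mathbf{x}(p))$: these are sets of variables with union $\{x_1,\dots,x_n\}$; $f=f_1+\dots+f_p$ with $f_\ell\in\mathbb{R}[\mathbf{x}(\ell)]$; and there is a partition $J_1,\dots,J_p$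 of $\{1,\dots,m\}$ (parts may be empty), which we fix, such that $g_j\in\mathbb{R}[\mathbf{x}(\ell)]$ for all $j\in J_\ell$. Suppose that it satisfies the running intersection property: for every $\ell\in\{1,\dots,p-1\}$ there is $s\in\{1,\dots,\ell\}$ with $\mathbf{x}(\ell+1)\cap\bigcup_{j=1}^{\ell}\mathbf{x}(j)\subseteq\mathbf{x}(s)$. Introduce one new variable $w_\ell$ for each $\ell=1,\dots,p$, put $\mathbf{w}=(w_1,\dots,w_p)$, $V_\ell=\{x_0\}\cup\mathbf{x}(\ell)\cup\{w_\ell\}$, $h_\ell=x_0^2+\sum_{x_i\in\mathbf{x}(\ell)}x_i^2+w_\ell^2-1$, $d=\deg f$, $d_0=2\lceil d/2\rceil$, and $$\widetilde K_s=\{(\tilde{\mathbf{x}},\mathbf{w})\in\mathbb{R}^{n+1+p} : x_0\ge 0,\ \tilde g_j(\tilde{\mathbf{x}})\ge 0\ (j=1,\dots,m),\ h_\ell(\tilde{\mathbf{x}},\mathbf{w})=0\ (\ell=1,\dots,p)\}.$$ For $\varepsilon>0$ and $\gamma\in\mathbb{R}$ let $$F_{\varepsilon,\gamma}=\tilde f(\tilde{\mathbf{x}})+\varepsilon\Big(\sum_{i=0}^n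 x_i^{d_0}+\sum_{\ell=1}^p w_\ell^{d_0}\Big)-\gamma x_0^d,$$ and let $f^{(\varepsilon)}$ be the supremum of all $\gamma\in\mathbb{R}$ such that $F_{\varepsilon,\gamma}\ge 0$ on $\widetilde K_s$. For $k\in\mathbb{N}$ let $f_k$ be the supremum of all $\gamma\in\mathbb{R}$ such that $$F_{\varepsilon,\gamma}=\sum_{\ell=1}^p\Big(\tau_\ell h_\ell+\sigma_{\ell}+\rho_\ell\, x_0+\sum_{j\in J_\ell}\sigma_{\ell,j}\,\tilde g_j\Big)$$ for some $\tau_\ell\in\mathbb{R}[V_\ell]$ and sums of squares $\sigma_\ell,\rho_\ell,\sigma_{\ell,j}$ of polynomials in $\mathbb{R}[V_\ell]$ with the degree bounds $$\deg\tau_\ell\le 2k-\deg h_\ell,\quad \deg\sigma_\ell\le 2k,\quad \deg\rho_\ell\le 2k-c,\quad \deg\sigma_{\ell,j}\le 2k-c\lceil\deg(\tilde g_j)/2\rceil,$$ where the zero polynomial satisfies every degree bound, and where the constant $c$ is either $1$ or $2$ (two customary ways to truncate). Suprema are taken in $[-\infty,+\infty]$. Then, for every $\varepsilon>0$ and for each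 of the two choices $c=1$ and $c=2$, $f_k\to f^{(\varepsilon)}$ in $[-\infty,+\infty]$ as $k\to\infty$. -/

import Mathlib

open MvPolynomial Filter Topology

namespace SparsePOP

noncomputable section

/-! ### The polynomial optimization problem and its homogenization -/

/-- The feasible set `K = {x ∈ ℝⁿ | g_j(x) ≥ 0, j = 1, …, m}`. -/
def feasibleSet {n m : ℕ} (g : Fin m → MvPolynomial (Fin n) ℝ) : Set (Fin n → ℝ) :=
  {x | ∀ j, 0 ≤ eval x (g j)}

/-- The homogenization `x₀ ^ deg q * q (x / x₀)` of `q ∈ ℝ[x₁, …, xₙ]`. The variable of index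
`0 : Fin (n + 1)` is the homogenizing variable `x₀`, and `xᵢ` becomes the variable `i.succ`. -/
def homog {n : ℕ} (q : MvPolynomial (Fin n) ℝ) : MvPolynomial (Fin (n + 1)) ℝ :=
  ∑ i ∈ Finset.range (q.totalDegree + 1),
    X 0 ^ (q.totalDegree - i) * rename Fin.succ (homogeneousComponent i q)

/-- The homogenized set
`{(x₀, x) ∈ ℝⁿ⁺¹ | g̃_j(x₀, x) ≥ 0 for all j, x₀ ≥ 0, x₀² + x₁² + ⋯ + xₙ² = 1}`. -/
def homogSet {n m : ℕ} (g : Fin m → MvPolynomial (Fin n) ℝ) : Set (Fin (n + 1) → ℝ) :=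
  {x | (∀ j, 0 ≤ eval x (homog (g j))) ∧ 0 ≤ x 0 ∧ ∑ i, x i ^ 2 = 1}

/-- `K` (as described by `g`) is closed at infinity. -/
def ClosedAtInfinity {n m : ℕ} (g : Fin m → MvPolynomial (Fin n) ℝ) : Prop :=
  homogSet g = closure (homogSet g ∩ {x | 0 < x 0})

/-! ### Correlative sparsity -/

/-- The problem with objective `f` and constraints `g` has the correlative sparsity pattern
`(x(1), …, x(p))`, where `I ℓ` is the set of indices of the variables in `x(ℓ)`. The partition
`J_1, …, J_p` of the constraints (with possibly empty parts) is given by the map `J` that sends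
`j` to the `ℓ` with `j ∈ J_ℓ`. -/
structure IsCSP {n m p : ℕ} (f : MvPolynomial (Fin n) ℝ) (g : Fin m → MvPolynomial (Fin n) ℝ)
    (I : Fin p → Finset (Fin n)) (J : Fin m → Fin p) : Prop where
  cover : ∀ i, ∃ ℓ, i ∈ I ℓ
  objective : ∃ F : Fin p → MvPolynomial (Fin n) ℝ,
    (∀ ℓ, F ℓ ∈ supported ℝ (I ℓ : Set (Fin n))) ∧ f = ∑ ℓ, F ℓ
  constraints : ∀ j, g j ∈ supported ℝ (I (J j) : Set (Fin n))

/-- The running intersection property: for every `ℓ` other than the first one there is an `s < ℓ`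
such that `x(ℓ) ∩ ⋃_{j < ℓ} x(j) ⊆ x(s)`. -/
def RunningIntersection {n p : ℕ} (I : Fin p → Finset (Fin n)) : Prop :=
  ∀ ℓ : Fin p, 0 < (ℓ : ℕ) → ∃ s, s < ℓ ∧ ∀ i ∈ I ℓ, (∃ j, j < ℓ ∧ i ∈ I j) → i ∈ I s

/-! ### Truncated ideals and quadratic modules in a subset of the variables -/

section Truncated

variable {σ : Type*}

/-- `q` belongs to `ℝ[x]_{D - e}`, the polynomials of degree at most `D - e`
(only the zero polynomial if `D < e`). -/
def DegLE (q : MvPolynomial σ ℝ) (e D : ℕ) : Prop :=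
  q = 0 ∨ q.totalDegree + e ≤ D

/-- `q` is a sum of squares of polynomials in the variables of `V`. -/
def IsSOSIn (V : Set σ) (q : MvPolynomial σ ℝ) : Prop :=
  ∃ (t : ℕ) (r : Fin t → MvPolynomial σ ℝ), (∀ i, r i ∈ supported ℝ V) ∧ q = ∑ i, r i ^ 2

/-- The truncation `h · ℝ[V]_{D - deg h}` in degree `D` of the ideal generated by `h` in the
polynomial ring `ℝ[V]` in the variables of `V`. -/
def truncIdeal (V : Set σ) (h : MvPolynomial σ ℝ) (D : ℕ) : Set (MvPolynomial σ ℝ) :=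
  {q | ∃ τ ∈ supported ℝ V, DegLE τ h.totalDegree D ∧ q = h * τ}

/-- The truncation `Σ[V]_D + ∑ᵢ gᵢ · Σ[V]_{D - c ⌈deg gᵢ / 2⌉}` in degree `D` of the quadratic
module generated by the `gᵢ` in the polynomial ring `ℝ[V]`. -/
def truncQM {ι : Type*} [Fintype ι] (c : ℕ) (V : Set σ) (g : ι → MvPolynomial σ ℝ) (D : ℕ) :
    Set (MvPolynomial σ ℝ) :=
  {q | ∃ (s₀ : MvPolynomial σ ℝ) (s : ι → MvPolynomial σ ℝ),
    IsSOSIn V s₀ ∧ DegLE s₀ 0 D ∧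
    (∀ i, IsSOSIn V (s i) ∧ DegLE (s i) (c * (((g i).totalDegree + 1) / 2)) D) ∧
    q = s₀ + ∑ i, g i * s i}

end Truncated

/-! ### The sparse homogenized reformulation with perturbation

The variables `(x₀, x₁, …, xₙ, w₁, …, w_p)` are indexed by `Fin (n + 1) ⊕ Fin p`. -/

section Hierarchy

variable {n m p : ℕ}

/-- The set of (indices of) variables `{x₀} ∪ x(ℓ) ∪ {w_ℓ}`. -/
def extClique (I : Fin p → Finset (Fin n)) (ℓ : Fin p) : Set (Fin (n + 1) ⊕ Fin p) :=
  {v | v = Sum.inl 0 ∨ (∃ i ∈ I ℓ, v = Sum.inl i.succ) ∨ v = Sum.inr ℓ}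

/-- `h_ℓ = x₀² + ∑_{i ∈ I ℓ} xᵢ² + w_ℓ² - 1`. -/
def sphere (I : Fin p → Finset (Fin n)) (ℓ : Fin p) :
    MvPolynomial (Fin (n + 1) ⊕ Fin p) ℝ :=
  X (Sum.inl 0) ^ 2 + ∑ i ∈ I ℓ, X (Sum.inl i.succ) ^ 2 + X (Sum.inr ℓ) ^ 2 - 1

/-- The homogenization of `q` as a polynomial in all the variables `(x₀, x, w)`. -/
def homogExt (p : ℕ) (q : MvPolynomial (Fin n) ℝ) : MvPolynomial (Fin (n + 1) ⊕ Fin p) ℝ :=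
  rename Sum.inl (homog q)

/-- The set of all `(x₀, x, w) ∈ ℝⁿ⁺¹⁺ᵖ` with `x₀ ≥ 0`, `g̃_j(x₀, x) ≥ 0` for all `j`, and
`x₀² + ∑_{i ∈ I ℓ} xᵢ² + w_ℓ² = 1` for all `ℓ`. -/
def sparseSet (g : Fin m → MvPolynomial (Fin n) ℝ) (I : Fin p → Finset (Fin n)) :
    Set (Fin (n + 1) ⊕ Fin p → ℝ) :=
  {z | 0 ≤ z (Sum.inl 0) ∧ (∀ j, 0 ≤ eval z (homogExt p (g j))) ∧
    ∀ ℓ, z (Sum.inl 0) ^ 2 + ∑ i ∈ I ℓ, z (Sum.inl i.succ) ^ 2 + z (Sum.inr ℓ) ^ 2 = 1}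

/-- `f̃ + ε (∑ᵢ xᵢ ^ d₀ + ∑_ℓ w_ℓ ^ d₀) - γ x₀ ^ d`, where `d = deg f` and `d₀ = 2 ⌈d / 2⌉`. -/
def pertPoly (p : ℕ) (f : MvPolynomial (Fin n) ℝ) (ε γ : ℝ) :
    MvPolynomial (Fin (n + 1) ⊕ Fin p) ℝ :=
  homogExt p f
    + C ε * (∑ i : Fin (n + 1), X (Sum.inl i) ^ (2 * ((f.totalDegree + 1) / 2))
      + ∑ ℓ : Fin p, X (Sum.inr ℓ) ^ (2 * ((f.totalDegree + 1) / 2)))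
    - C γ * X (Sum.inl 0) ^ f.totalDegree

/-- The optimal value `f^(ε)` of the perturbed sparse homogenized reformulation: the supremum of
all `γ` for which `pertPoly p f ε γ` is nonnegative on `sparseSet g I`. -/
def pertValue (f : MvPolynomial (Fin n) ℝ) (g : Fin m → MvPolynomial (Fin n) ℝ)
    (I : Fin p → Finset (Fin n)) (ε : ℝ) : EReal :=
  ⨆ γ ∈ {γ : ℝ | ∀ z ∈ sparseSet g I, 0 ≤ eval z (pertPoly p f ε γ)}, (γ : EReal)

/-- The family `{x₀} ∪ {g̃_j}_{j ∈ J_ℓ}`. -/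
def blockConstraints (g : Fin m → MvPolynomial (Fin n) ℝ) (J : Fin m → Fin p) (ℓ : Fin p) :
    Option {j // J j = ℓ} → MvPolynomial (Fin (n + 1) ⊕ Fin p) ℝ
  | none => X (Sum.inl 0)
  | some j => homogExt p (g j)

/-- The cone in the `k`-th sparse homogenized SOS relaxation: the sum over `ℓ` of the truncations
in degree `2k` of the ideal generated by `h_ℓ` and of the quadratic module generated by
`{x₀} ∪ {g̃_j}_{j ∈ J_ℓ}`, both taken in the polynomial ring in the variables
`{x₀} ∪ x(ℓ) ∪ {w_ℓ}`. -/
def sosCone (c : ℕ) (g : Fin m → MvPolynomial (Fin n) ℝ) (I : Fin p → Finset (Fin n))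
    (J : Fin m → Fin p) (k : ℕ) : Set (MvPolynomial (Fin (n + 1) ⊕ Fin p) ℝ) :=
  {q | ∃ a b : Fin p → MvPolynomial (Fin (n + 1) ⊕ Fin p) ℝ,
    (∀ ℓ, a ℓ ∈ truncIdeal (extClique I ℓ) (sphere I ℓ) (2 * k)) ∧
    (∀ ℓ, b ℓ ∈ truncQM c (extClique I ℓ) (blockConstraints g J ℓ) (2 * k)) ∧
    q = ∑ ℓ, (a ℓ + b ℓ)}

/-- The optimal value `f_k` of the `k`-th sparse homogenized SOS relaxation with perturbation.
The multiplier of a constraint `q` has degree at most `2k - c ⌈deg q / 2⌉`. -/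
def sosValue (c : ℕ) (f : MvPolynomial (Fin n) ℝ) (g : Fin m → MvPolynomial (Fin n) ℝ)
    (I : Fin p → Finset (Fin n)) (J : Fin m → Fin p) (ε : ℝ) (k : ℕ) : EReal :=
  ⨆ γ ∈ {γ : ℝ | pertPoly p f ε γ ∈ sosCone c g I J k}, (γ : EReal)

end Hierarchy

end

end SparsePOP

open SparsePOP

/-!
Membership in the truncated cone forces nonnegativity on `sparseSet g I`, so every `f_k` is at most
`f^(ε)`, and the theorem amounts to a sparse Positivstellensatz: for each real `γ < f^(ε)` the
polynomial `F_{ε,γ}` lies in the cone for all large `k`.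

It is strictly positive on `sparseSet g I` (`eval_pertPoly_pos`). Where `x₀ > 0`, lowering `γ` gains
a positive multiple of `x₀ ^ d`. At `x₀ = 0` the homogenization of `f` is nonnegative, because the
lower bound of `f` on `K` passes to the closure of `homogSet g ∩ {x₀ > 0}`, and the perturbation is
positive on the spheres.

Each block of variables has its own sphere constraint, and the blocks `{x₀} ∪ x(ℓ) ∪ {w_ℓ}` inherit
the running intersection property. A sum of polynomials in the blocks that is positive on the
compact set cut out by all constraints can therefore be rewritten as a sum of such polynomials with
the `ℓ`-th one positive wherever the constraints of the `ℓ`-th block hold (`exists_sum_eq_and_pos`).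
This is proved by splitting off the last block: on its overlap with the earlier ones, the correction
to be moved between the two parts may be any function strictly between the fibrewise maximum of one
and the fibrewise minimum of the other. A partition of unity provides a continuous one, and the
Stone–Weierstrass theorem a polynomial one (`exists_supported_pos_of_glued_pos`).

Each summand then has a certificate by Putinar's theorem, since the sphere equation makes the
quadratic module of the block Archimedean (`exists_eq_sphere_mul_add_of_pos`). Putinar's theorem
follows from Jacobi's representation theorem (`IsQuadraticModule.mem_of_forall_algHom_pos`), whose
proof is algebraic: a maximal proper quadratic module that is Archimedean defines a real point, so
that an `f` positive at all real points of `M` satisfies `p * f - 1 ∈ M` for a sum of squares `p`,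
and this certificate raises any lower bound of `f` modulo `M` step by step to `0`.
-/

namespace SparsePOP

/-! ### Archimedean quadratic modules -/

section QuadraticModule

variable {A : Type*} [CommRing A]

/-- `M` is a quadratic module of the commutative ring `A`. Properness (`-1 ∉ M`) is not required. -/
structure IsQuadraticModule (M : Set A) : Prop where
  one_mem : 1 ∈ M
  add_mem : ∀ {a b}, a ∈ M → b ∈ M → a + b ∈ M
  sq_mul_mem : ∀ (a) {b}, b ∈ M → a ^ 2 * b ∈ M

namespace IsQuadraticModule

variable {M : Set A}

theorem zero_mem (hM : IsQuadraticModule M) : 0 ∈ M := by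
  simpa using hM.sq_mul_mem 0 hM.one_mem

theorem sq_mem (hM : IsQuadraticModule M) (a : A) : a ^ 2 ∈ M := by
  simpa using hM.sq_mul_mem a hM.one_mem

theorem isSumSq_mul_mem (hM : IsQuadraticModule M) {s b : A} (hs : IsSumSq s) (hb : b ∈ M) :
    s * b ∈ M := by
  induction hs with
  | zero => simpa using hM.zero_mem
  | sq_add a _ ih =>
    rw [add_mul, ← sq]
    exact hM.add_mem (hM.sq_mul_mem a hb) ih

theorem isSumSq_mem (hM : IsQuadraticModule M) {s : A} (hs : IsSumSq s) : s ∈ M := by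
  simpa using hM.isSumSq_mul_mem hs hM.one_mem

/-- Adjoining one element to a quadratic module. -/
theorem adjoin (hM : IsQuadraticModule M) (a : A) :
    IsQuadraticModule {x | ∃ m ∈ M, ∃ s, IsSumSq s ∧ x = m + s * a} where
  one_mem := ⟨1, hM.one_mem, 0, IsSumSq.zero, by simp⟩
  add_mem := by
    rintro _ _ ⟨m, hm, s, hs, rfl⟩ ⟨m', hm', s', hs', rfl⟩
    exact ⟨m + m', hM.add_mem hm hm', s + s', hs.add hs', by ring⟩
  sq_mul_mem := by
    rintro b _ ⟨m, hm, s, hs, rfl⟩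
    exact ⟨b ^ 2 * m, hM.sq_mul_mem b hm, b ^ 2 * s, (IsSquare.sq b).isSumSq.mul hs, by ring⟩

theorem exists_maximal (hM : IsQuadraticModule M) (hM1 : -1 ∉ M) :
    ∃ Q, M ⊆ Q ∧ Maximal (fun Q : Set A ↦ IsQuadraticModule Q ∧ -1 ∉ Q) Q := by
  refine zorn_subset_nonempty {Q : Set A | IsQuadraticModule Q ∧ -1 ∉ Q} ?_ M ⟨hM, hM1⟩
  intro c hc hchain hne
  refine ⟨⋃₀ c, ⟨⟨?_, ?_, ?_⟩, ?_⟩, fun s hs ↦ Set.subset_sUnion_of_mem hs⟩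
  · obtain ⟨s, hs⟩ := hne
    exact ⟨s, hs, (hc hs).1.one_mem⟩
  · rintro a b ⟨s, hs, ha⟩ ⟨t, ht, hb⟩
    rcases hchain.total hs ht with h | h
    · exact ⟨t, ht, (hc ht).1.add_mem (h ha) hb⟩
    · exact ⟨s, hs, (hc hs).1.add_mem ha (h hb)⟩
  · rintro a b ⟨s, hs, hb⟩
    exact ⟨s, hs, (hc hs).1.sq_mul_mem a hb⟩
  · rintro ⟨s, hs, h⟩
    exact (hc hs).2 h

variable [Algebra ℝ A]

theorem algebraMap_mul_mem (hM : IsQuadraticModule M) {r : ℝ} (hr : 0 ≤ r) {b : A} (hb : b ∈ M) :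
    algebraMap ℝ A r * b ∈ M := by
  have := hM.sq_mul_mem (algebraMap ℝ A (√r)) hb
  rwa [← map_pow, Real.sq_sqrt hr] at this

theorem algebraMap_mem (hM : IsQuadraticModule M) {r : ℝ} (hr : 0 ≤ r) : algebraMap ℝ A r ∈ M := by
  simpa using hM.algebraMap_mul_mem hr hM.one_mem

theorem mem_of_algebraMap_mul_mem (hM : IsQuadraticModule M) {r : ℝ} (hr : 0 < r) {b : A}
    (hb : algebraMap ℝ A r * b ∈ M) : b ∈ M := by
  have := hM.algebraMap_mul_mem (inv_nonneg.2 hr.le) hb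
  rwa [← mul_assoc, ← map_mul, inv_mul_cancel₀ hr.ne', map_one, one_mul] at this

theorem nonneg_of_algebraMap_mem (hM : IsQuadraticModule M) (h1 : -1 ∉ M) {r : ℝ}
    (h : algebraMap ℝ A r ∈ M) : 0 ≤ r := by
  by_contra! hr
  refine h1 (hM.mem_of_algebraMap_mul_mem (r := -r) (by linarith) ?_)
  simpa using h

/-- The support `M ∩ -M` of a quadratic module is an ideal. -/
theorem mul_mem_of_neg_mem (hM : IsQuadraticModule M) (a : A) {x : A} (hx : x ∈ M)
    (hx' : -x ∈ M) : a * x ∈ M := by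
  have h2 : algebraMap ℝ A (1 / 2) * 2 = 1 := by
    rw [← map_ofNat (algebraMap ℝ A) 2, ← map_mul]; norm_num
  set h := algebraMap ℝ A (1 / 2)
  have := hM.add_mem (hM.sq_mul_mem (h * (a + 1)) hx) (hM.sq_mul_mem (h * (a - 1)) hx')
  convert this using 1
  linear_combination (-(a * x) * (h * 2 + 1)) * h2

theorem mem_or_neg_mem_of_maximal
    (hM : Maximal (fun Q : Set A ↦ IsQuadraticModule Q ∧ -1 ∉ Q) M) (a : A) :
    a ∈ M ∨ -a ∈ M := by
  have hq := hM.prop.1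
  have key : ∀ b, b ∉ M → ∃ m ∈ M, ∃ s, IsSumSq s ∧ -1 = m + s * b := by
    intro b hb
    by_contra hcon
    refine hb (hM.le_of_ge ⟨hq.adjoin b, hcon⟩ (fun m hm ↦ ⟨m, hm, 0, IsSumSq.zero, by simp⟩)
      ⟨0, hq.zero_mem, 1, IsSquare.one.isSumSq, by simp⟩)
  by_contra! hcon
  obtain ⟨q₁, hq₁, s₁, hs₁, e₁⟩ := key a hcon.1
  obtain ⟨q₂, hq₂, s₂, hs₂, e₂⟩ := key (-a) hcon.2
  -- Eliminating `a` from the two identities puts `s₁` in the ideal `M ∩ -M`.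
  have hneg : -s₁ ∈ M := by
    have := hq.add_mem (hq.isSumSq_mem hs₂)
      (hq.add_mem (hq.isSumSq_mul_mem hs₁ hq₂) (hq.isSumSq_mul_mem hs₂ hq₁))
    convert this using 1
    linear_combination s₁ * e₂ + s₂ * e₁
  refine hM.prop.2 ?_
  rw [e₁, mul_comm s₁]
  exact hq.add_mem hq₁ (hq.mul_mem_of_neg_mem a (hq.isSumSq_mem hs₁) hneg)

/-- `a` lies infinitely close to the real number `c` with respect to the preorder
`x ≤ y ↔ y - x ∈ M`. -/
def IsNear (M : Set A) (a : A) (c : ℝ) : Prop :=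
  ∀ ε > 0, a - algebraMap ℝ A (c - ε) ∈ M ∧ algebraMap ℝ A (c + ε) - a ∈ M

theorem IsNear.unique (hM : IsQuadraticModule M) (h1 : -1 ∉ M) {a : A} {c d : ℝ}
    (hc : IsNear M a c) (hd : IsNear M a d) : c = d := by
  have key : ∀ {c d : ℝ}, IsNear M a c → IsNear M a d → c ≤ d := by
    intro c d hc hd
    refine le_of_forall_pos_le_add fun ε hε ↦ ?_
    have := hM.nonneg_of_algebraMap_mem h1 (r := d + ε / 2 - (c - ε / 2)) (by
      rw [map_sub]
      convert hM.add_mem (hc _ (half_pos hε)).1 (hd _ (half_pos hε)).2 using 1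
      ring)
    linarith
  exact le_antisymm (key hc hd) (key hd hc)

theorem IsNear.add (hM : IsQuadraticModule M) {a b : A} {c d : ℝ}
    (hc : IsNear M a c) (hd : IsNear M b d) : IsNear M (a + b) (c + d) := by
  intro ε hε
  constructor
  · convert hM.add_mem (hc _ (half_pos hε)).1 (hd _ (half_pos hε)).1 using 1
    rw [show c + d - ε = (c - ε / 2) + (d - ε / 2) by ring, map_add]
    ring
  · convert hM.add_mem (hc _ (half_pos hε)).2 (hd _ (half_pos hε)).2 using 1
    rw [show c + d + ε = (c + ε / 2) + (d + ε / 2) by ring, map_add]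
    ring

theorem IsNear.neg {a : A} {c : ℝ} (hc : IsNear M a c) : IsNear M (-a) (-c) := by
  intro ε hε
  constructor
  · convert (hc _ hε).2 using 1
    rw [show -c - ε = -(c + ε) by ring, map_neg]
    ring
  · convert (hc _ hε).1 using 1
    rw [show -c + ε = -(c - ε) by ring, map_neg]
    ring

theorem isNear_algebraMap (hM : IsQuadraticModule M) (r : ℝ) : IsNear M (algebraMap ℝ A r) r := by
  intro ε hε
  rw [← map_sub, ← map_sub]
  exact ⟨hM.algebraMap_mem (by linarith), hM.algebraMap_mem (by linarith)⟩

theorem IsNear.algebraMap_mul (hM : IsQuadraticModule M) {a : A} {c : ℝ} (hc : IsNear M a c)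
    (r : ℝ) : IsNear M (algebraMap ℝ A r * a) (r * c) := by
  have key : ∀ r : ℝ, 0 < r → IsNear M (algebraMap ℝ A r * a) (r * c) := by
    intro r hr ε hε
    have hrε : r * (ε / r) = ε := by field_simp
    constructor
    · convert hM.algebraMap_mul_mem hr.le (hc _ (div_pos hε hr)).1 using 1
      rw [mul_sub, ← map_mul, mul_sub, hrε]
    · convert hM.algebraMap_mul_mem hr.le (hc _ (div_pos hε hr)).2 using 1
      rw [mul_sub, ← map_mul, mul_add, hrε]
  rcases lt_trichotomy r 0 with hr | rfl | hr
  · simpa using (key (-r) (by linarith)).neg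
  · simpa using isNear_algebraMap hM 0
  · exact key r hr

/-- If `-r ≤ a ≤ r` in the preorder given by a quadratic module, then `a ^ 2 ≤ r ^ 2`. -/
theorem sq_le (hM : IsQuadraticModule M) {a : A} {r : ℝ} (hr : 0 < r)
    (h₁ : algebraMap ℝ A r - a ∈ M) (h₂ : algebraMap ℝ A r + a ∈ M) :
    algebraMap ℝ A (r ^ 2) - a ^ 2 ∈ M := by
  refine hM.mem_of_algebraMap_mul_mem (r := 2 * r) (by linarith) ?_
  have := hM.add_mem (hM.sq_mul_mem (algebraMap ℝ A r - a) h₂)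
    (hM.sq_mul_mem (algebraMap ℝ A r + a) h₁)
  convert this using 1
  simp only [map_mul, map_pow, map_ofNat]
  ring

theorem IsNear.sq (hM : IsQuadraticModule M) {a : A} {c : ℝ} (hc : IsNear M a c) :
    IsNear M (a ^ 2) (c ^ 2) := by
  have key : ∀ b : A, IsNear M b 0 → IsNear M (b ^ 2) 0 := by
    intro b hb ε hε
    constructor
    · rw [zero_sub, map_neg, sub_neg_eq_add]
      exact hM.add_mem (hM.sq_mem b) (hM.algebraMap_mem hε.le)
    · have h := hb _ (Real.sqrt_pos.2 hε)
      rw [zero_sub, map_neg, sub_neg_eq_add, zero_add, add_comm b] at h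
      have := hM.sq_le (Real.sqrt_pos.2 hε) h.2 h.1
      rwa [Real.sq_sqrt hε.le, ← zero_add ε] at this
  have h0 : IsNear M (a + algebraMap ℝ A (-c)) 0 := by
    simpa using hc.add hM (isNear_algebraMap hM (-c))
  have := ((key _ h0).add hM (hc.algebraMap_mul hM (2 * c))).add hM
    (isNear_algebraMap hM (-(c ^ 2)))
  convert this using 1
  · simp only [map_neg, map_mul, map_pow, map_ofNat]; ring
  · ring

theorem IsNear.mul (hM : IsQuadraticModule M) {a b : A} {c d : ℝ} (hc : IsNear M a c)
    (hd : IsNear M b d) : IsNear M (a * b) (c * d) := by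
  have := (((hc.add hM hd).sq hM).add hM ((hc.add hM hd.neg).sq hM).neg).algebraMap_mul hM (1 / 4)
  convert this using 1
  · have h4 : algebraMap ℝ A (1 / 4) * 4 = 1 := by
      rw [← map_ofNat (algebraMap ℝ A) 4, ← map_mul]; norm_num
    linear_combination (-(a * b)) * h4
  · ring

theorem exists_isNear (hM : IsQuadraticModule M) (h1 : -1 ∉ M) (htot : ∀ a, a ∈ M ∨ -a ∈ M)
    (harch : ∀ a, ∃ r : ℝ, algebraMap ℝ A r - a ∈ M) (a : A) : ∃ c, IsNear M a c := by
  set S : Set ℝ := {r | a - algebraMap ℝ A r ∈ M} with hS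
  have hne : S.Nonempty := by
    obtain ⟨r, hr⟩ := harch (-a)
    refine ⟨-r, show a - algebraMap ℝ A (-r) ∈ M from ?_⟩
    convert hr using 1
    rw [map_neg]
    ring
  have hbdd : BddAbove S := by
    obtain ⟨R, hR⟩ := harch a
    refine ⟨R, fun r hr ↦ ?_⟩
    have := hM.nonneg_of_algebraMap_mem h1 (r := R - r) (by
      convert hM.add_mem hR hr using 1
      rw [map_sub]
      ring)
    linarith
  refine ⟨sSup S, fun ε hε ↦ ⟨?_, ?_⟩⟩
  · obtain ⟨r, hr, hlt⟩ := exists_lt_of_lt_csSup hne (show sSup S - ε < sSup S by linarith)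
    convert hM.add_mem hr (hM.algebraMap_mem (r := r - (sSup S - ε)) (by linarith)) using 1
    rw [map_sub _ r]
    ring
  · have hnot : a - algebraMap ℝ A (sSup S + ε) ∉ M := fun h ↦ by
      have := le_csSup hbdd (show sSup S + ε ∈ S from h)
      linarith
    simpa using (htot _).resolve_left hnot

/-- The preorder of an Archimedean proper quadratic module `M` with `M ∪ -M = A` is total, and the
real number infinitely close to an element is its value at a real point of `A`. -/
theorem exists_algHom_of_total (hM : IsQuadraticModule M) (h1 : -1 ∉ M)
    (htot : ∀ a, a ∈ M ∨ -a ∈ M) (harch : ∀ a, ∃ r : ℝ, algebraMap ℝ A r - a ∈ M) :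
    ∃ φ : A →ₐ[ℝ] ℝ, ∀ a ∈ M, 0 ≤ φ a := by
  choose φ hφ using hM.exists_isNear h1 htot harch
  refine ⟨
    { toFun := φ
      map_one' := (hφ 1).unique hM h1 (by simpa using isNear_algebraMap hM (1 : ℝ))
      map_mul' := fun a b ↦ (hφ _).unique hM h1 ((hφ a).mul hM (hφ b))
      map_zero' := (hφ 0).unique hM h1 (by simpa using isNear_algebraMap hM (0 : ℝ))
      map_add' := fun a b ↦ (hφ _).unique hM h1 ((hφ a).add hM (hφ b))
      commutes' := fun r ↦ (hφ _).unique hM h1 (isNear_algebraMap hM r) }, fun a ha ↦ ?_⟩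
  refine le_of_forall_pos_le_add fun ε hε ↦ ?_
  refine hM.nonneg_of_algebraMap_mem h1 (r := φ a + ε) ?_
  simpa using hM.add_mem (hφ a ε hε).2 ha

/-- One step of the descent in Jacobi's theorem: a certificate `p * f - 1 ∈ M` with `p` a sum of
squares lets a lower bound `-r ≤ f` be raised by a fixed amount. -/
theorem add_sub_mem_of_isSumSq (hM : IsQuadraticModule M) {f p : A} (hp : IsSumSq p)
    (hpf : p * f - 1 ∈ M) {k : ℝ} (hk : 0 < k) (hk₁ : algebraMap ℝ A (2 * k) - p ∈ M)
    (hk₂ : algebraMap ℝ A (2 * k - 1) - p ^ 2 * f ∈ M) {r : ℝ} (hr : 0 ≤ r)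
    (hf : f + algebraMap ℝ A r ∈ M) : f + algebraMap ℝ A (r - 1 / k ^ 2) ∈ M := by
  -- With `q = 2 * k - p`: `2 * k * (p * q) = p ^ 2 * q + q ^ 2 * p`.
  have hpk : p * (algebraMap ℝ A (2 * k) - p) ∈ M := by
    refine hM.mem_of_algebraMap_mul_mem (r := 2 * k) (by linarith) ?_
    convert hM.add_mem (hM.sq_mul_mem p hk₁)
      (hM.sq_mul_mem (algebraMap ℝ A (2 * k) - p) (hM.isSumSq_mem hp)) using 1
    ring
  refine hM.mem_of_algebraMap_mul_mem (r := k ^ 2) (by positivity) ?_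
  -- `k² (f + r) - 1 = (k - p)² (f + r) + 2k (p f - 1) + r p (2k - p) + (2k - 1 - p² f)`
  have := hM.add_mem (hM.add_mem (hM.add_mem (hM.sq_mul_mem (algebraMap ℝ A k - p) hf)
    (hM.algebraMap_mul_mem (r := 2 * k) (by linarith) hpf)) (hM.algebraMap_mul_mem hr hpk)) hk₂
  convert this using 1
  have e : k ^ 2 * (r - 1 / k ^ 2) = k ^ 2 * r - 1 := by field_simp
  rw [mul_add, ← map_mul, e]
  simp only [map_sub, map_mul, map_pow, map_ofNat, map_one]
  ring

/-- Jacobi's representation theorem: an element that is positive at all real points at which an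
Archimedean quadratic module is nonnegative belongs to the module. -/
theorem mem_of_forall_algHom_pos (hM : IsQuadraticModule M)
    (harch : ∀ a, ∃ r : ℝ, algebraMap ℝ A r - a ∈ M) (f : A)
    (hf : ∀ φ : A →ₐ[ℝ] ℝ, (∀ a ∈ M, 0 ≤ φ a) → 0 < φ f) : f ∈ M := by
  obtain ⟨p, hp, hpf⟩ : ∃ p, IsSumSq p ∧ p * f - 1 ∈ M := by
    by_cases h1 : -1 ∈ {x | ∃ m ∈ M, ∃ s, IsSumSq s ∧ x = m + s * (-f)}
    · obtain ⟨m, hm, s, hs, e⟩ := h1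
      refine ⟨s, hs, ?_⟩
      rw [sub_eq_add_neg, e]
      simpa using hm
    · obtain ⟨Q, hMQ, hQ⟩ := (hM.adjoin (-f)).exists_maximal h1
      have hMQ' : M ⊆ Q := fun m hm ↦ hMQ ⟨m, hm, 0, IsSumSq.zero, by simp⟩
      obtain ⟨φ, hφ⟩ := hQ.prop.1.exists_algHom_of_total hQ.prop.2
        (mem_or_neg_mem_of_maximal hQ) (fun a ↦ (harch a).imp fun r hr ↦ hMQ' hr)
      have h2 := hφ (-f) (hMQ ⟨0, hM.zero_mem, 1, IsSquare.one.isSumSq, by simp⟩)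
      rw [map_neg] at h2
      have := hf φ fun a ha ↦ hφ a (hMQ' ha)
      linarith
  have mono : ∀ {a : A} {r s : ℝ}, r ≤ s → algebraMap ℝ A r - a ∈ M →
      algebraMap ℝ A s - a ∈ M := by
    intro a r s hrs h
    convert hM.add_mem h (hM.algebraMap_mem (sub_nonneg.2 hrs)) using 1
    rw [map_sub]
    ring
  obtain ⟨r₁, hr₁⟩ := harch p
  obtain ⟨r₂, hr₂⟩ := harch (p ^ 2 * f)
  obtain ⟨r₀, hr₀⟩ := harch (-f)
  set k : ℝ := |r₁| + |r₂| + 1 with hkdef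
  have hk : 0 < k := by positivity
  have hk₁ := mono (s := 2 * k) (by linarith [le_abs_self r₁, abs_nonneg r₁, abs_nonneg r₂]) hr₁
  have hk₂ := mono (s := 2 * k - 1) (by linarith [le_abs_self r₂, abs_nonneg r₁, abs_nonneg r₂]) hr₂
  have step : ∀ N : ℕ, f + algebraMap ℝ A (max 0 (|r₀| - N * (1 / k ^ 2))) ∈ M := by
    intro N
    induction N with
    | zero =>
      have := mono (s := max 0 (|r₀| - (0 : ℕ) * (1 / k ^ 2))) (by simp [le_abs_self]) hr₀
      rwa [sub_neg_eq_add, add_comm] at this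
    | succ N ih =>
      have h := hM.add_sub_mem_of_isSumSq hp hpf hk hk₁ hk₂ (le_max_left _ _) ih
      have h' := hM.add_mem h (hM.algebraMap_mem
        (r := max 0 (|r₀| - (N + 1 : ℕ) * (1 / k ^ 2))
          - (max 0 (|r₀| - N * (1 / k ^ 2)) - 1 / k ^ 2)) (by
            push_cast
            have : 0 < 1 / k ^ 2 := by positivity
            rcases max_cases 0 (|r₀| - N * (1 / k ^ 2)) with h | h
            · rw [h.1]
              linarith [le_max_left 0 (|r₀| - (N + 1) * (1 / k ^ 2))]
            · rw [h.1]
              linarith [le_max_right 0 (|r₀| - (N + 1) * (1 / k ^ 2))]))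
      convert h' using 1
      rw [add_assoc, ← map_add]
      congr 2
      ring
  obtain ⟨N, hN⟩ := exists_nat_gt (|r₀| / (1 / k ^ 2))
  have hN' : max 0 (|r₀| - N * (1 / k ^ 2)) = 0 := by
    rw [max_eq_left]
    rw [div_lt_iff₀ (by positivity)] at hN
    linarith
  have := step N
  rwa [hN', map_zero, add_zero] at this

/-- The elements bounded above and below with respect to a quadratic module form a subalgebra. -/
def boundedSubalgebra (hM : IsQuadraticModule M) : Subalgebra ℝ A where
  carrier := {a | ∃ r : ℝ, 0 < r ∧ algebraMap ℝ A r - a ∈ M ∧ algebraMap ℝ A r + a ∈ M}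
  algebraMap_mem' := fun r ↦ ⟨|r| + 1, by positivity, by
      rw [← map_sub]; exact hM.algebraMap_mem (by linarith [le_abs_self r]), by
      rw [← map_add]; exact hM.algebraMap_mem (by linarith [neg_abs_le r])⟩
  add_mem' := by
    rintro a b ⟨r, hr, h₁, h₂⟩ ⟨s, hs, h₃, h₄⟩
    refine ⟨r + s, by positivity, ?_, ?_⟩
    · convert hM.add_mem h₁ h₃ using 1
      rw [map_add]; ring
    · convert hM.add_mem h₂ h₄ using 1
      rw [map_add]; ring
  mul_mem' := by
    rintro a b ⟨r, hr, h₁, h₂⟩ ⟨s, hs, h₃, h₄⟩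
    have p₁ := hM.sq_le (a := a + b) (r := r + s) (by positivity)
      (by convert hM.add_mem h₁ h₃ using 1; rw [map_add]; ring)
      (by convert hM.add_mem h₂ h₄ using 1; rw [map_add]; ring)
    have p₂ := hM.sq_le (a := a - b) (r := r + s) (by positivity)
      (by convert hM.add_mem h₁ h₄ using 1; rw [map_add]; ring)
      (by convert hM.add_mem h₂ h₃ using 1; rw [map_add]; ring)
    refine ⟨(r + s) ^ 2, by positivity, ?_, ?_⟩
    · refine hM.mem_of_algebraMap_mul_mem (r := 4) (by norm_num) ?_
      convert hM.add_mem (hM.add_mem p₁ (hM.sq_mem (a - b)))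
        (hM.algebraMap_mem (r := 3 * (r + s) ^ 2) (by positivity)) using 1
      simp only [map_mul, map_pow, map_add, map_ofNat]
      ring
    · refine hM.mem_of_algebraMap_mul_mem (r := 4) (by norm_num) ?_
      convert hM.add_mem (hM.add_mem p₂ (hM.sq_mem (a + b)))
        (hM.algebraMap_mem (r := 3 * (r + s) ^ 2) (by positivity)) using 1
      simp only [map_mul, map_pow, map_add, map_ofNat]
      ring

theorem mem_boundedSubalgebra_of_one_sub_sq_mem (hM : IsQuadraticModule M) {a : A}
    (h : 1 - a ^ 2 ∈ M) : a ∈ hM.boundedSubalgebra := by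
  have key : ∀ b : A, 1 - b ^ 2 ∈ M → 1 + b ∈ M := by
    intro b hb
    refine hM.mem_of_algebraMap_mul_mem (r := 2) (by norm_num) ?_
    convert hM.add_mem (hM.sq_mem (1 + b)) hb using 1
    rw [map_ofNat]
    ring
  refine ⟨1, one_pos, ?_, ?_⟩
  · rw [map_one, sub_eq_add_neg]
    exact key _ (by simpa using h)
  · rw [map_one]
    exact key _ h

end IsQuadraticModule

end QuadraticModule

/-! ### Splitting a positive sparse polynomial into positive summands -/

section Splitting

theorem exists_between_of_isCompact {A B : Set ℝ} (hA : IsCompact A) (hB : IsCompact B)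
    (h : ∀ a ∈ A, ∀ b ∈ B, a < b) : ∃ c, (∀ a ∈ A, a < c) ∧ ∀ b ∈ B, c < b := by
  rcases A.eq_empty_or_nonempty with rfl | hAne
  · obtain ⟨b₀, hb₀⟩ := hB.bddBelow
    exact ⟨b₀ - 1, by simp, fun b hb ↦ by linarith [hb₀ hb]⟩
  rcases B.eq_empty_or_nonempty with rfl | hBne
  · obtain ⟨a₀, ha₀⟩ := hA.bddAbove
    exact ⟨a₀ + 1, fun a ha ↦ by linarith [ha₀ ha], by simp⟩
  obtain ⟨a, ha, hmax⟩ := hA.exists_isGreatest hAne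
  obtain ⟨b, hb, hmin⟩ := hB.exists_isLeast hBne
  obtain ⟨c, hac, hcb⟩ := exists_between (h a ha b hb)
  exact ⟨c, fun x hx ↦ (hmax hx).trans_lt hac, fun x hx ↦ hcb.trans_le (hmin hx)⟩

theorem exists_pos_forall_le_of_isCompact {X : Type*} [TopologicalSpace X] {K : Set X}
    (hK : IsCompact K) {φ : X → ℝ} (hφ : Continuous φ) (hpos : ∀ x ∈ K, 0 < φ x) :
    ∃ δ > 0, ∀ x ∈ K, δ ≤ φ x := by
  rcases K.eq_empty_or_nonempty with rfl | hne
  · exact ⟨1, one_pos, by simp⟩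
  · obtain ⟨x, hx, hmin⟩ := hK.exists_isMinOn hne hφ.continuousOn
    exact ⟨φ x, hpos x hx, fun y hy ↦ hmin hy⟩

theorem exists_mvPolynomial_near_of_isCompact {ι : Type*} {K : Set (ι → ℝ)} (hK : IsCompact K)
    (θ : C(ι → ℝ, ℝ)) {ε : ℝ} (hε : 0 < ε) :
    ∃ q : MvPolynomial ι ℝ, ∀ x ∈ K, |eval x q - θ x| < ε := by
  let Φ : MvPolynomial ι ℝ →ₐ[ℝ] C(ι → ℝ, ℝ) :=
    aeval fun i ↦ (⟨fun x ↦ x i, continuous_apply i⟩ : C(ι → ℝ, ℝ))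
  have hΦ : ∀ q x, Φ q x = eval x q := by
    intro q x
    induction q using MvPolynomial.induction_on with
    | C a => simp [Φ, _root_.algebraMap_apply]
    | add p q hp hq => simp [hp, hq]
    | mul_X p i hp => simp [hp]; simp [Φ]
  have hsep : Φ.range.SeparatesPoints := by
    intro x y hxy
    obtain ⟨i, hi⟩ := Function.ne_iff.1 hxy
    exact ⟨Φ (X i), ⟨Φ (X i), ⟨X i, rfl⟩, rfl⟩, by simpa [hΦ] using hi⟩
  obtain ⟨_, ⟨q, rfl⟩, hq⟩ :=
    ContinuousMap.exists_mem_subalgebra_near_continuous_of_isCompact_of_separatesPoints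
      hsep θ hK hε
  exact ⟨q, fun x hx ↦ by simpa [hΦ] using hq x hx⟩

theorem eval_eq_of_mem_supported {σ : Type*} {V : Set σ} {q : MvPolynomial σ ℝ}
    (hq : q ∈ supported ℝ V) {z z' : σ → ℝ} (h : Set.EqOn z z' V) : eval z q = eval z' q := by
  rw [mem_supported] at hq
  exact eval₂Hom_congr' rfl (fun i hi _ ↦ h (hq hi)) rfl

/-- If `f₁ + f₂` is positive on pairs of points of two compact sets that agree on the coordinates
in `U`, then adding to `f₁` and subtracting from `f₂` a polynomial in these coordinates makes both
positive. A continuous such function is a selection of the intervals between the maximum of `-f₁`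
and the minimum of `f₂` on the fibres; the polynomial approximates it. -/
theorem exists_supported_pos_of_glued_pos {σ : Type*} (U : Set σ) [Finite U]
    {C₁ C₂ : Set (σ → ℝ)} (hC₁ : IsCompact C₁) (hC₂ : IsCompact C₂) {f₁ f₂ : (σ → ℝ) → ℝ}
    (hf₁ : Continuous f₁) (hf₂ : Continuous f₂)
    (hpos : ∀ z₁ ∈ C₁, ∀ z₂ ∈ C₂, Set.EqOn z₁ z₂ U → 0 < f₁ z₁ + f₂ z₂) :
    ∃ q ∈ supported ℝ U, (∀ z ∈ C₁, 0 < f₁ z + eval z q) ∧ ∀ z ∈ C₂, 0 < f₂ z - eval z q := by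
  cases nonempty_fintype U
  have hr : Continuous (U.domRestrict : (σ → ℝ) → U → ℝ) := Pi.continuous_domRestrict U
  obtain ⟨θ, hθ⟩ : ∃ θ : C(U → ℝ, ℝ), ∀ y, θ y ∈ {c : ℝ |
      (∀ z ∈ C₁, U.domRestrict z = y → -f₁ z < c) ∧ ∀ z ∈ C₂, U.domRestrict z = y → c < f₂ z} := by
    refine exists_continuous_forall_mem_convex_of_local_const (fun y ↦ ?_) fun y ↦ ?_
    · rw [convex_iff_ordConnected]
      refine ⟨fun a ha b hb c hc ↦ ⟨fun z hz hzy ↦ (ha.1 z hz hzy).trans_le hc.1,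
        fun z hz hzy ↦ hc.2.trans_lt (hb.2 z hz hzy)⟩⟩
    · have hfib : ∀ {C : Set (σ → ℝ)}, IsCompact C → IsCompact (C ∩ U.domRestrict ⁻¹' {y}) :=
        fun hC ↦ hC.inter_right (isClosed_singleton.preimage hr)
      obtain ⟨c, hc₁, hc₂⟩ := exists_between_of_isCompact
        ((hfib hC₁).image hf₁.neg) ((hfib hC₂).image hf₂) (by
          rintro _ ⟨z₁, hz₁, rfl⟩ _ ⟨z₂, hz₂, rfl⟩
          have := hpos z₁ hz₁.1 z₂ hz₂.1 fun u hu ↦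
            congrFun (hz₁.2.trans hz₂.2.symm) (⟨u, hu⟩ : U)
          rw [Pi.neg_apply]
          linarith)
      refine ⟨c, ?_⟩
      -- The points where `c` is not admissible have compact images, which miss `y`.
      have h₁ : IsCompact (U.domRestrict '' (C₁ ∩ {z | c ≤ -f₁ z})) :=
        (hC₁.inter_right (isClosed_le continuous_const hf₁.neg)).image hr
      have h₂ : IsCompact (U.domRestrict '' (C₂ ∩ {z | f₂ z ≤ c})) :=
        (hC₂.inter_right (isClosed_le hf₂ continuous_const)).image hr
      have m₁ : y ∉ U.domRestrict '' (C₁ ∩ {z | c ≤ -f₁ z}) := by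
        rintro ⟨z, ⟨hz, hle⟩, hzy⟩
        exact (hc₁ _ ⟨z, ⟨hz, hzy⟩, rfl⟩).not_ge hle
      have m₂ : y ∉ U.domRestrict '' (C₂ ∩ {z | f₂ z ≤ c}) := by
        rintro ⟨z, ⟨hz, hle⟩, hzy⟩
        exact (hc₂ _ ⟨z, ⟨hz, hzy⟩, rfl⟩).not_ge hle
      filter_upwards [h₁.isClosed.isOpen_compl.mem_nhds m₁,
        h₂.isClosed.isOpen_compl.mem_nhds m₂] with y' n₁ n₂
      refine ⟨fun z hz hzy ↦ ?_, fun z hz hzy ↦ ?_⟩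
      · by_contra! hle
        exact n₁ ⟨z, ⟨hz, hle⟩, hzy⟩
      · by_contra! hle
        exact n₂ ⟨z, ⟨hz, hle⟩, hzy⟩
  have hθr : Continuous fun z : σ → ℝ ↦ θ (U.domRestrict z) := θ.continuous.comp hr
  obtain ⟨δ₁, hδ₁, hle₁⟩ := exists_pos_forall_le_of_isCompact hC₁
    (φ := fun z ↦ f₁ z + θ (U.domRestrict z)) (hf₁.add hθr)
    fun z hz ↦ by linarith [(hθ (U.domRestrict z)).1 z hz rfl]
  obtain ⟨δ₂, hδ₂, hle₂⟩ := exists_pos_forall_le_of_isCompact hC₂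
    (φ := fun z ↦ f₂ z - θ (U.domRestrict z)) (hf₂.sub hθr)
    fun z hz ↦ by linarith [(hθ (U.domRestrict z)).2 z hz rfl]
  obtain ⟨q, hq⟩ := exists_mvPolynomial_near_of_isCompact ((hC₁.image hr).union (hC₂.image hr)) θ
    (lt_min hδ₁ hδ₂)
  have heval : ∀ z, eval z (rename Subtype.val q) = eval (U.domRestrict z) q := fun z ↦ by
    rw [eval_rename]; rfl
  refine ⟨rename Subtype.val q, ?_, fun z hz ↦ ?_, fun z hz ↦ ?_⟩
  · rw [supported_eq_range_rename]
    exact ⟨q, rfl⟩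
  · have h := abs_lt.1 (hq _ (Or.inl ⟨z, hz, rfl⟩))
    rw [heval]
    linarith [min_le_left δ₁ δ₂, hle₁ z hz]
  · have h := abs_lt.1 (hq _ (Or.inr ⟨z, hz, rfl⟩))
    rw [heval]
    linarith [min_le_right δ₁ δ₂, hle₂ z hz]

/-- Under the running intersection property, a sum of polynomials `F ℓ` in the variables of `V ℓ`
that is positive on the intersection of compact cylinders `C ℓ` over sets of `V ℓ`-coordinates
is a sum of polynomials in the variables of `V ℓ` that are positive on `C ℓ`. The cylinders are
taken inside a product of subsets `b v` of the line, which is what makes compactness possible. -/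
theorem exists_sum_eq_and_pos {σ : Type*} [Finite σ] {b : σ → Set ℝ} {p : ℕ}
    (V : Fin p → Set σ) (C : Fin p → Set (σ → ℝ)) (F : Fin p → MvPolynomial σ ℝ)
    (hrip : ∀ ℓ : Fin p, 0 < (ℓ : ℕ) → ∃ s, s < ℓ ∧ ∀ v ∈ V ℓ, (∃ j, j < ℓ ∧ v ∈ V j) → v ∈ V s)
    (hF : ∀ ℓ, F ℓ ∈ supported ℝ (V ℓ)) (hC : ∀ ℓ, IsCompact (C ℓ))
    (hCb : ∀ ℓ, C ℓ ⊆ Set.univ.pi b)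
    (hsat : ∀ ℓ, ∀ z ∈ C ℓ, ∀ z' ∈ Set.univ.pi b, Set.EqOn z z' (V ℓ) → z' ∈ C ℓ)
    (hpos : ∀ z, (∀ ℓ, z ∈ C ℓ) → 0 < eval z (∑ ℓ, F ℓ)) :
    ∃ H : Fin p → MvPolynomial σ ℝ, (∀ ℓ, H ℓ ∈ supported ℝ (V ℓ)) ∧ ∑ ℓ, H ℓ = ∑ ℓ, F ℓ ∧
      ∀ ℓ, ∀ z ∈ C ℓ, 0 < eval z (H ℓ) := by
  classical
  induction p with
  | zero => exact ⟨F, hF, rfl, fun ℓ ↦ ℓ.elim0⟩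
  | succ p ih =>
    rcases Nat.eq_zero_or_pos p with rfl | hp
    · have : Subsingleton (Fin (0 + 1)) := inferInstanceAs (Subsingleton (Fin 1))
      refine ⟨F, hF, rfl, fun ℓ z hz ↦ ?_⟩
      have := hpos z fun i ↦ by rwa [Subsingleton.elim i ℓ]
      rwa [Fintype.sum_subsingleton _ ℓ] at this
    obtain ⟨s, hs, hsub⟩ := hrip (Fin.last p) (by simpa using hp)
    obtain ⟨s, rfl⟩ := Fin.exists_castSucc_eq.2 hs.ne
    obtain ⟨q, hqU, hq₁, hq₂⟩ := exists_supported_pos_of_glued_pos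
      (V (Fin.last p) ∩ ⋃ j : Fin p, V j.castSucc)
      ((hC s.castSucc).of_isClosed_subset (isClosed_iInter fun j ↦ (hC (Fin.castSucc j)).isClosed)
        (Set.iInter_subset (fun j : Fin p ↦ C j.castSucc) s)) (hC (Fin.last p))
      (f₁ := fun z ↦ eval z (∑ j : Fin p, F j.castSucc)) (f₂ := fun z ↦ eval z (F (Fin.last p)))
      (continuous_eval _) (continuous_eval _) (by
        intro z₁ hz₁ z₂ hz₂ heq
        rw [Set.mem_iInter] at hz₁
        -- Two points that agree on the overlap glue to one point of all the cylinders.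
        let z : σ → ℝ := fun v ↦ if v ∈ V (Fin.last p) then z₂ v else z₁ v
        have hzb : z ∈ Set.univ.pi b := by
          intro v hv
          by_cases hvl : v ∈ V (Fin.last p)
          · simpa [z, hvl] using hCb _ hz₂ v hv
          · simpa [z, hvl] using hCb s.castSucc (hz₁ s) v hv
        have e₂ : Set.EqOn z₂ z (V (Fin.last p)) := fun v hv ↦ by simp [z, hv]
        have e₁ : ∀ j : Fin p, Set.EqOn z₁ z (V j.castSucc) := by
          intro j v hv
          by_cases hvl : v ∈ V (Fin.last p)
          · simpa [z, hvl] using heq ⟨hvl, Set.mem_iUnion.2 ⟨j, hv⟩⟩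
          · simp [z, hvl]
        have := hpos z (Fin.lastCases (hsat _ z₂ hz₂ z hzb e₂)
          fun j ↦ hsat _ z₁ (hz₁ j) z hzb (e₁ j))
        rw [Fin.sum_univ_castSucc, map_add] at this
        rw [eval_eq_of_mem_supported (hF (Fin.last p)) e₂]
        convert this using 2
        rw [map_sum, map_sum]
        exact Finset.sum_congr rfl fun j _ ↦ eval_eq_of_mem_supported (hF _) (e₁ j))
    have hqs : q ∈ supported ℝ (V s.castSucc) := by
      refine supported_mono ?_ hqU
      rintro v ⟨hv, hv'⟩
      obtain ⟨j, hj⟩ := Set.mem_iUnion.1 hv'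
      exact hsub v hv ⟨j.castSucc, Fin.castSucc_lt_last j, hj⟩
    have hsum : ∑ j : Fin p, (F j.castSucc + if j = s then q else 0)
        = ∑ j : Fin p, F j.castSucc + q := by
      rw [Finset.sum_add_distrib, Finset.sum_ite_eq' _ s]
      simp
    obtain ⟨H, hH, hHsum, hHpos⟩ := ih (fun j ↦ V j.castSucc) (fun j ↦ C j.castSucc)
      (fun j ↦ F j.castSucc + if j = s then q else 0)
      (by
        intro j hj
        obtain ⟨t, ht, htsub⟩ := hrip j.castSucc (by simpa using hj)
        obtain ⟨t, rfl⟩ := Fin.exists_castSucc_eq.2 (ht.trans (Fin.castSucc_lt_last j)).ne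
        exact ⟨t, ht, fun v hv ⟨i, hi, hvi⟩ ↦ htsub v hv ⟨i.castSucc, hi, hvi⟩⟩)
      (by
        intro j
        refine add_mem (hF _) ?_
        split_ifs with h
        · rwa [h]
        · exact zero_mem _)
      (fun j ↦ hC _) (fun j ↦ hCb _) (fun j ↦ hsat _)
      (by
        intro z hz
        rw [hsum, map_add]
        exact hq₁ z (Set.mem_iInter.2 hz))
    -- The correction `q` is subtracted from the last summand and, as its variables lie in `V s`,
    -- it has been added to the summand of index `s`.
    refine ⟨Fin.snoc H (F (Fin.last p) - q), ?_, ?_, ?_⟩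
    · refine Fin.lastCases ?_ fun j ↦ ?_
      · rw [Fin.snoc_last]
        exact sub_mem (hF _) (supported_mono Set.inter_subset_left hqU)
      · rw [Fin.snoc_castSucc]
        exact hH j
    · rw [Fin.sum_univ_castSucc, Fin.sum_univ_castSucc, Fin.snoc_last]
      simp only [Fin.snoc_castSucc]
      rw [hHsum, hsum]
      ring
    · refine Fin.lastCases ?_ fun j ↦ ?_
      · rw [Fin.snoc_last]
        intro z hz
        rw [map_sub]
        exact hq₂ z hz
      · rw [Fin.snoc_castSucc]
        exact hHpos j

end Splitting

/-! ### Homogenization -/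

section Homogenization

theorem eval_smul_of_isHomogeneous {σ : Type*} {q : MvPolynomial σ ℝ} {d : ℕ}
    (hq : q.IsHomogeneous d) (t : ℝ) (x : σ → ℝ) : eval (t • x) q = t ^ d * eval x q := by
  rw [eval_eq, eval_eq, Finset.mul_sum]
  refine Finset.sum_congr rfl fun m hm ↦ ?_
  simp only [Pi.smul_apply, smul_eq_mul, mul_pow, Finset.prod_mul_distrib]
  rw [Finset.prod_pow_eq_pow_sum, ← hq.degree_eq_sum_deg_support hm]
  ring

variable {n m p : ℕ}

theorem isHomogeneous_homog (q : MvPolynomial (Fin n) ℝ) :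
    (homog q).IsHomogeneous q.totalDegree := by
  refine IsHomogeneous.sum _ _ _ fun i hi ↦ ?_
  have h := (isHomogeneous_X_pow (R := ℝ) (0 : Fin (n + 1)) (q.totalDegree - i)).mul
    ((homogeneousComponent_isHomogeneous i q).rename_isHomogeneous (f := Fin.succ))
  rwa [Nat.sub_add_cancel (Nat.lt_succ_iff.1 (Finset.mem_range.1 hi))] at h

theorem eval_cons_one_homog (q : MvPolynomial (Fin n) ℝ) (y : Fin n → ℝ) :
    eval (Fin.cons 1 y : Fin (n + 1) → ℝ) (homog q) = eval y q := by
  conv_rhs => rw [← sum_homogeneousComponent q]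
  rw [homog, map_sum, map_sum]
  refine Finset.sum_congr rfl fun i _ ↦ ?_
  rw [map_mul, map_pow, eval_X, eval_rename, Fin.cons_zero, one_pow, one_mul]
  rfl

theorem eval_homog_of_pos (q : MvPolynomial (Fin n) ℝ) {x : Fin (n + 1) → ℝ} (hx : 0 < x 0) :
    eval x (homog q) = x 0 ^ q.totalDegree * eval (fun i ↦ x i.succ / x 0) q := by
  rw [← eval_cons_one_homog q, ← eval_smul_of_isHomogeneous (isHomogeneous_homog q)]
  congr 2
  funext i
  refine Fin.cases ?_ (fun i ↦ ?_) i
  · simp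
  · simp [mul_div_cancel₀ _ hx.ne']

/-- A lower bound `B` of `f` on `K` gives the lower bound `B * x₀ ^ d` of the homogenization: it
holds where `x₀ > 0`, and extends to all of `homogSet g` because `K` is closed at infinity. -/
theorem exists_forall_mul_pow_le_eval_homog {f : MvPolynomial (Fin n) ℝ}
    {g : Fin m → MvPolynomial (Fin n) ℝ} (hf : BddBelow ((fun x => eval x f) '' feasibleSet g))
    (hK : ClosedAtInfinity g) :
    ∃ B, ∀ x ∈ homogSet g, B * x 0 ^ f.totalDegree ≤ eval x (homog f) := by
  obtain ⟨B, hB⟩ := hf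
  refine ⟨B, fun x hx ↦ ?_⟩
  have hclosed : IsClosed {x : Fin (n + 1) → ℝ | B * x 0 ^ f.totalDegree ≤ eval x (homog f)} :=
    isClosed_le (by fun_prop) (continuous_eval _)
  have hsub : homogSet g ∩ {x | 0 < x 0} ⊆
      {x : Fin (n + 1) → ℝ | B * x 0 ^ f.totalDegree ≤ eval x (homog f)} := by
    rintro y ⟨hy, hy0⟩
    have hmem : (fun i : Fin n ↦ y i.succ / y 0) ∈ feasibleSet g := fun j ↦ by
      have := hy.1 j
      rw [eval_homog_of_pos _ hy0] at this
      exact nonneg_of_mul_nonneg_right this (pow_pos hy0 _)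
    have hle := hB ⟨_, hmem, rfl⟩
    change B * y 0 ^ f.totalDegree ≤ eval y (homog f)
    rw [eval_homog_of_pos _ hy0, mul_comm]
    exact mul_le_mul_of_nonneg_left hle (pow_pos hy0 _).le
  rw [hK] at hx
  exact closure_minimal hsub hclosed hx

theorem eval_homog_nonneg_of_apply_zero_eq_zero {f : MvPolynomial (Fin n) ℝ}
    {g : Fin m → MvPolynomial (Fin n) ℝ} (hf : BddBelow ((fun x => eval x f) '' feasibleSet g))
    (hK : ClosedAtInfinity g) (hd : f.totalDegree ≠ 0) {x : Fin (n + 1) → ℝ} (hx0 : x 0 = 0)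
    (hx : ∀ j, 0 ≤ eval x (homog (g j))) : 0 ≤ eval x (homog f) := by
  rcases eq_or_ne x 0 with rfl | hne
  · have := eval_smul_of_isHomogeneous (isHomogeneous_homog f) 0 0
    rw [smul_zero, zero_pow hd, zero_mul] at this
    exact this.ge
  have hN : 0 < ∑ i, x i ^ 2 := by
    obtain ⟨i, hi⟩ := Function.ne_iff.1 hne
    exact Finset.sum_pos' (fun i _ ↦ sq_nonneg _) ⟨i, Finset.mem_univ _, sq_pos_of_ne_zero hi⟩
  set t := (√(∑ i, x i ^ 2))⁻¹ with ht
  have htpos : 0 < t := inv_pos.2 (Real.sqrt_pos.2 hN)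
  obtain ⟨B, hB⟩ := exists_forall_mul_pow_le_eval_homog hf hK
  have hmem : t • x ∈ homogSet g := by
    refine ⟨fun j ↦ ?_, ?_, ?_⟩
    · rw [eval_smul_of_isHomogeneous (isHomogeneous_homog _)]
      exact mul_nonneg (pow_pos htpos _).le (hx j)
    · simp [hx0]
    · simp only [Pi.smul_apply, smul_eq_mul, mul_pow]
      rw [← Finset.mul_sum, ht, inv_pow, Real.sq_sqrt hN.le, inv_mul_cancel₀ hN.ne']
  have := hB _ hmem
  rw [eval_smul_of_isHomogeneous (isHomogeneous_homog _), Pi.smul_apply, hx0, smul_zero,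
    zero_pow hd, mul_zero] at this
  exact nonneg_of_mul_nonneg_right this (pow_pos htpos _)

theorem eval_homogExt (q : MvPolynomial (Fin n) ℝ) (z : Fin (n + 1) ⊕ Fin p → ℝ) :
    eval z (homogExt p q) = eval (z ∘ Sum.inl) (homog q) := by
  rw [homogExt, eval_rename]

theorem eval_pertPoly (f : MvPolynomial (Fin n) ℝ) (ε γ : ℝ) (z : Fin (n + 1) ⊕ Fin p → ℝ) :
    eval z (pertPoly p f ε γ) = eval (z ∘ Sum.inl) (homog f)
      + ε * (∑ i, z (Sum.inl i) ^ (2 * ((f.totalDegree + 1) / 2))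
        + ∑ ℓ, z (Sum.inr ℓ) ^ (2 * ((f.totalDegree + 1) / 2)))
      - γ * z (Sum.inl 0) ^ f.totalDegree := by
  simp [pertPoly, eval_homogExt]

/-- Lowering `γ` makes the perturbed polynomial strictly positive. Where `x₀ > 0` the gain is
`(γ' - γ) * x₀ ^ d`; at infinity, that is for `x₀ = 0`, the homogenization of `f` is nonnegative
and the perturbation is positive, as the origin does not lie on the spheres. -/
theorem eval_pertPoly_pos {f : MvPolynomial (Fin n) ℝ} {g : Fin m → MvPolynomial (Fin n) ℝ}
    {I : Fin p → Finset (Fin n)} (hf : BddBelow ((fun x => eval x f) '' feasibleSet g))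
    (hK : ClosedAtInfinity g) (hp : 0 < p) {ε γ γ' : ℝ} (hε : 0 < ε) (hγ : γ < γ')
    (h : ∀ z ∈ sparseSet g I, 0 ≤ eval z (pertPoly p f ε γ')) (z : Fin (n + 1) ⊕ Fin p → ℝ)
    (hz : z ∈ sparseSet g I) : 0 < eval z (pertPoly p f ε γ) := by
  have hgain : 0 < z (Sum.inl 0) ^ f.totalDegree → 0 < eval z (pertPoly p f ε γ) := by
    intro hpow
    have h₁ := h z hz
    have h₂ := mul_lt_mul_of_pos_right hγ hpow
    rw [eval_pertPoly] at h₁ ⊢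
    linarith
  rcases Nat.eq_zero_or_pos f.totalDegree with hd | hd
  · exact hgain (by simp [hd])
  rcases hz.1.lt_or_eq with h0 | h0
  · exact hgain (pow_pos h0 _)
  have hnn : 0 ≤ eval (z ∘ Sum.inl) (homog f) :=
    eval_homog_nonneg_of_apply_zero_eq_zero hf hK hd.ne' h0.symm fun j ↦ by
      simpa [eval_homogExt] using hz.2.1 j
  have hev : Even (2 * ((f.totalDegree + 1) / 2)) := even_two_mul _
  have hs₁ : 0 ≤ ∑ i, z (Sum.inl i) ^ (2 * ((f.totalDegree + 1) / 2)) :=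
    Finset.sum_nonneg fun i _ ↦ hev.pow_nonneg _
  have hs₂ : 0 ≤ ∑ ℓ, z (Sum.inr ℓ) ^ (2 * ((f.totalDegree + 1) / 2)) :=
    Finset.sum_nonneg fun i _ ↦ hev.pow_nonneg _
  have hsum : 0 < ∑ i, z (Sum.inl i) ^ (2 * ((f.totalDegree + 1) / 2))
      + ∑ ℓ, z (Sum.inr ℓ) ^ (2 * ((f.totalDegree + 1) / 2)) := by
    refine (add_nonneg hs₁ hs₂).lt_of_ne' fun hcon ↦ ?_
    have hd₀ : 2 * ((f.totalDegree + 1) / 2) ≠ 0 := by omega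
    have e₁ := (Finset.sum_eq_zero_iff_of_nonneg fun i _ ↦ hev.pow_nonneg _).1
      (le_antisymm (by linarith) hs₁)
    have e₂ := (Finset.sum_eq_zero_iff_of_nonneg fun i _ ↦ hev.pow_nonneg _).1
      (le_antisymm (by linarith) hs₂)
    have z₁ : ∀ i, z (Sum.inl i) = 0 := fun i ↦ (pow_eq_zero_iff hd₀).1 (e₁ i (Finset.mem_univ _))
    have z₂ : ∀ ℓ, z (Sum.inr ℓ) = 0 := fun ℓ ↦ (pow_eq_zero_iff hd₀).1 (e₂ ℓ (Finset.mem_univ _))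
    have := hz.2.2 ⟨0, hp⟩
    simp [z₁, z₂] at this
  rw [eval_pertPoly, ← h0, zero_pow hd.ne', mul_zero, sub_zero]
  linarith [mul_pos hε hsum]

end Homogenization

/-! ### Sparsity of the homogenized problem -/

section Sparsity

theorem rename_mem_supported {σ τ : Type*} {V : Set σ} {W : Set τ} {φ : σ → τ}
    (hφ : Set.MapsTo φ V W) {q : MvPolynomial σ ℝ} (hq : q ∈ supported ℝ V) :
    rename φ q ∈ supported ℝ W := by
  classical
  rw [mem_supported] at hq ⊢
  intro w hw
  obtain ⟨v, hv, rfl⟩ := Finset.mem_image.1 (vars_rename φ q hw)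
  exact hφ (hq hv)

theorem homogeneousComponent_mem_supported {σ : Type*} {V : Set σ} {q : MvPolynomial σ ℝ}
    (hq : q ∈ supported ℝ V) (i : ℕ) : homogeneousComponent i q ∈ supported ℝ V := by
  classical
  rw [mem_supported] at hq ⊢
  intro v hv
  obtain ⟨d, hd, hvd⟩ := (mem_vars_iff_mem_support v).1 hv
  rw [support_homogeneousComponent] at hd
  exact hq ((mem_vars_iff_mem_support v).2 ⟨d, (Finset.mem_filter.1 hd).1, hvd⟩)

variable {n m p : ℕ}

theorem X_inl_zero_mem_supported (I : Fin p → Finset (Fin n)) (ℓ : Fin p) :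
    (X (Sum.inl 0) : MvPolynomial (Fin (n + 1) ⊕ Fin p) ℝ) ∈ supported ℝ (extClique I ℓ) :=
  X_mem_supported.2 (Or.inl rfl)

theorem rename_succ_mem_supported (I : Fin p → Finset (Fin n)) (ℓ : Fin p)
    {q : MvPolynomial (Fin n) ℝ} (hq : q ∈ supported ℝ (I ℓ : Set (Fin n))) :
    rename Sum.inl (rename Fin.succ q) ∈ supported ℝ (extClique I ℓ) := by
  rw [rename_rename]
  exact rename_mem_supported (W := extClique I ℓ) (fun i hi ↦ Or.inr (Or.inl ⟨i, hi, rfl⟩)) hq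

theorem homogExt_mem_supported (I : Fin p → Finset (Fin n)) (ℓ : Fin p)
    {q : MvPolynomial (Fin n) ℝ} (hq : q ∈ supported ℝ (I ℓ : Set (Fin n))) :
    homogExt p q ∈ supported ℝ (extClique I ℓ) := by
  rw [homogExt, homog, map_sum]
  refine sum_mem fun i _ ↦ ?_
  rw [map_mul, map_pow, rename_X]
  exact mul_mem (pow_mem (X_inl_zero_mem_supported I ℓ) _)
    (rename_succ_mem_supported I ℓ (homogeneousComponent_mem_supported hq i))

/-- The summands of `f` may have larger degrees than `f`, so that it is not their homogenizations
that are added up, but their homogeneous components of degree at most `deg f`. -/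
theorem exists_pertPoly_eq_sum {f : MvPolynomial (Fin n) ℝ} {g : Fin m → MvPolynomial (Fin n) ℝ}
    {I : Fin p → Finset (Fin n)} {J : Fin m → Fin p} (hcsp : IsCSP f g I J) (hp : 0 < p)
    (ε γ : ℝ) : ∃ F : Fin p → MvPolynomial (Fin (n + 1) ⊕ Fin p) ℝ,
      (∀ ℓ, F ℓ ∈ supported ℝ (extClique I ℓ)) ∧ pertPoly p f ε γ = ∑ ℓ, F ℓ := by
  set S : Submodule ℝ (MvPolynomial (Fin (n + 1) ⊕ Fin p) ℝ) :=
    ⨆ ℓ, Subalgebra.toSubmodule (supported ℝ (extClique I ℓ)) with hS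
  have hmem : ∀ ℓ, ∀ q ∈ supported ℝ (extClique I ℓ), q ∈ S := fun ℓ q hq ↦
    Submodule.mem_iSup_of_mem (p := fun ℓ ↦ Subalgebra.toSubmodule (supported ℝ (extClique I ℓ)))
      ℓ hq
  have hX : ∀ v (k : ℕ), (X v ^ k : MvPolynomial (Fin (n + 1) ⊕ Fin p) ℝ) ∈ S := by
    intro v k
    obtain ⟨ℓ, hℓ⟩ : ∃ ℓ, v ∈ extClique I ℓ := by
      rcases v with i | ℓ
      · refine Fin.cases ⟨⟨0, hp⟩, Or.inl rfl⟩ (fun i ↦ ?_) i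
        obtain ⟨ℓ, hℓ⟩ := hcsp.cover i
        exact ⟨ℓ, Or.inr (Or.inl ⟨i, hℓ, rfl⟩)⟩
      · exact ⟨ℓ, Or.inr (Or.inr rfl)⟩
    exact hmem ℓ _ (pow_mem (X_mem_supported.2 hℓ) k)
  have hf : homogExt p f ∈ S := by
    obtain ⟨F, hF, hfF⟩ := hcsp.objective
    rw [homogExt, homog, map_sum]
    refine sum_mem fun i _ ↦ ?_
    have : homogeneousComponent i f = ∑ ℓ, homogeneousComponent i (F ℓ) := by rw [hfF, map_sum]
    rw [this, map_sum, Finset.mul_sum, map_sum]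
    refine sum_mem fun ℓ _ ↦ hmem ℓ _ ?_
    rw [map_mul, map_pow, rename_X]
    exact mul_mem (pow_mem (X_inl_zero_mem_supported I ℓ) _)
      (rename_succ_mem_supported I ℓ (homogeneousComponent_mem_supported (hF ℓ) i))
  have hpert : pertPoly p f ε γ ∈ S := by
    rw [pertPoly, ← smul_eq_C_mul, ← smul_eq_C_mul]
    exact sub_mem (add_mem hf (S.smul_mem _ (add_mem (sum_mem fun i _ ↦ hX _ _)
      (sum_mem fun ℓ _ ↦ hX _ _)))) (S.smul_mem _ (hX _ _))
  obtain ⟨F, hF, hsum⟩ := (Submodule.mem_iSup_iff_exists_finsupp _ _).1 hpert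
  exact ⟨F, hF, by rw [← hsum, Finsupp.sum_fintype _ _ fun _ ↦ rfl]⟩

/-- The variables `x₀`, `w_ℓ` and `xᵢ` with `i ∈ I ℓ` as a finite set. -/
def extCliqueFinset (I : Fin p → Finset (Fin n)) (ℓ : Fin p) : Finset (Fin (n + 1) ⊕ Fin p) :=
  insert (Sum.inl 0) (insert (Sum.inr ℓ)
    ((I ℓ).map ((Fin.succEmb n).trans Function.Embedding.inl)))

theorem coe_extCliqueFinset (I : Fin p → Finset (Fin n)) (ℓ : Fin p) :
    (extCliqueFinset I ℓ : Set (Fin (n + 1) ⊕ Fin p)) = extClique I ℓ := by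
  ext v
  simp only [extCliqueFinset, extClique, Finset.coe_insert, Set.mem_insert_iff, Finset.mem_coe,
    Finset.mem_map, Set.mem_ofPred_eq]
  constructor
  · rintro (h | h | ⟨i, hi, rfl⟩)
    exacts [Or.inl h, Or.inr (Or.inr h), Or.inr (Or.inl ⟨i, hi, rfl⟩)]
  · rintro (h | ⟨i, hi, rfl⟩ | h)
    exacts [Or.inl h, Or.inr (Or.inr ⟨i, hi, rfl⟩), Or.inr (Or.inl h)]

theorem sum_extCliqueFinset {R : Type*} [AddCommMonoid R] (I : Fin p → Finset (Fin n)) (ℓ : Fin p)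
    (φ : Fin (n + 1) ⊕ Fin p → R) : ∑ v ∈ extCliqueFinset I ℓ, φ v =
      φ (Sum.inl 0) + ∑ i ∈ I ℓ, φ (Sum.inl i.succ) + φ (Sum.inr ℓ) := by
  rw [extCliqueFinset, Finset.sum_insert, Finset.sum_insert, Finset.sum_map]
  · simp only [Function.Embedding.trans_apply]
    rw [add_assoc, add_comm (φ (Sum.inr ℓ))]
    rfl
  · simp
  · simp

theorem sphere_eq (I : Fin p → Finset (Fin n)) (ℓ : Fin p) :
    sphere I ℓ = ∑ v ∈ extCliqueFinset I ℓ, X v ^ 2 - 1 := by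
  rw [sum_extCliqueFinset, sphere]

theorem RunningIntersection.extClique {I : Fin p → Finset (Fin n)} (h : RunningIntersection I) :
    ∀ ℓ : Fin p, 0 < (ℓ : ℕ) → ∃ s, s < ℓ ∧ ∀ v ∈ extClique I ℓ,
      (∃ j, j < ℓ ∧ v ∈ SparsePOP.extClique I j) → v ∈ SparsePOP.extClique I s := by
  intro ℓ hℓ
  obtain ⟨s, hs, hsub⟩ := h ℓ hℓ
  refine ⟨s, hs, ?_⟩
  rintro v (rfl | ⟨i, hi, rfl⟩ | rfl) ⟨j, hj, hv⟩
  · exact Or.inl rfl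
  · refine Or.inr (Or.inl ⟨i, hsub i hi ⟨j, hj, ?_⟩, rfl⟩)
    rcases hv with h | ⟨i', hi', h⟩ | h
    · simp at h
    · simp only [Sum.inl.injEq, Fin.succ_inj] at h
      rwa [h]
    · simp at h
  · rcases hv with h | ⟨i', hi', h⟩ | h
    · simp at h
    · simp at h
    · simp only [Sum.inr.injEq] at h
      exact absurd h hj.ne'

end Sparsity

/-! ### Putinar's Positivstellensatz on a part of the unit sphere -/

section Putinar

variable {σ : Type*} {V : Set σ}

theorem IsSOSIn.zero : IsSOSIn V 0 := ⟨0, Fin.elim0, fun i ↦ i.elim0, by simp⟩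

theorem IsSOSIn.sq {a : MvPolynomial σ ℝ} (ha : a ∈ supported ℝ V) : IsSOSIn V (a ^ 2) :=
  ⟨1, fun _ ↦ a, fun _ ↦ ha, by simp⟩

theorem IsSOSIn.one : IsSOSIn V 1 := by
  simpa using IsSOSIn.sq (one_mem (supported ℝ V))

theorem IsSOSIn.add {a b : MvPolynomial σ ℝ} (ha : IsSOSIn V a) (hb : IsSOSIn V b) :
    IsSOSIn V (a + b) := by
  obtain ⟨s, r, hr, rfl⟩ := ha
  obtain ⟨t, r', hr', rfl⟩ := hb
  refine ⟨s + t, Fin.append r r', fun i ↦ ?_, ?_⟩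
  · refine Fin.addCases (fun i ↦ ?_) (fun i ↦ ?_) i
    · simpa using hr i
    · simpa using hr' i
  · rw [Fin.sum_univ_add]
    simp

theorem IsSOSIn.sum {ι : Type*} (S : Finset ι) {a : ι → MvPolynomial σ ℝ}
    (ha : ∀ i ∈ S, IsSOSIn V (a i)) : IsSOSIn V (∑ i ∈ S, a i) :=
  Finset.sum_induction a (IsSOSIn V) (fun _ _ ↦ IsSOSIn.add) IsSOSIn.zero ha

theorem IsSOSIn.sq_mul {a b : MvPolynomial σ ℝ} (ha : a ∈ supported ℝ V) (hb : IsSOSIn V b) :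
    IsSOSIn V (a ^ 2 * b) := by
  obtain ⟨t, r, hr, rfl⟩ := hb
  exact ⟨t, fun i ↦ a * r i, fun i ↦ mul_mem ha (hr i), by simp [Finset.mul_sum, mul_pow]⟩

theorem IsSOSIn.eval_nonneg {a : MvPolynomial σ ℝ} (ha : IsSOSIn V a) (z : σ → ℝ) :
    0 ≤ eval z a := by
  obtain ⟨t, r, -, rfl⟩ := ha
  rw [map_sum]
  exact Finset.sum_nonneg fun i _ ↦ by rw [map_pow]; exact sq_nonneg _

variable {ι : Type*} [Fintype ι]

/-- The sum, in the polynomial ring `ℝ[V]`, of the ideal generated by `h` and the quadratic module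
generated by the `g i`, without bounds on the degrees. -/
def idealAddQM (V : Set σ) (h : MvPolynomial σ ℝ) (g : ι → MvPolynomial σ ℝ) :
    Set (supported ℝ V) :=
  {a | ∃ τ ∈ supported ℝ V, ∃ (s₀ : MvPolynomial σ ℝ) (s : ι → MvPolynomial σ ℝ),
    IsSOSIn V s₀ ∧ (∀ i, IsSOSIn V (s i)) ∧ (a : MvPolynomial σ ℝ) = h * τ + (s₀ + ∑ i, g i * s i)}

theorem isQuadraticModule_idealAddQM (V : Set σ) (h : MvPolynomial σ ℝ)
    (g : ι → MvPolynomial σ ℝ) : IsQuadraticModule (idealAddQM V h g) where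
  one_mem := ⟨0, zero_mem _, 1, fun _ ↦ 0, IsSOSIn.one, fun _ ↦ IsSOSIn.zero, by simp⟩
  add_mem := by
    rintro a b ⟨τ, hτ, s₀, s, hs₀, hs, ha⟩ ⟨τ', hτ', s₀', s', hs₀', hs', hb⟩
    refine ⟨τ + τ', add_mem hτ hτ', s₀ + s₀', fun i ↦ s i + s' i, hs₀.add hs₀',
      fun i ↦ (hs i).add (hs' i), ?_⟩
    simp only [Subalgebra.coe_add, ha, hb, mul_add, Finset.sum_add_distrib]
    ring
  sq_mul_mem := by
    rintro a b ⟨τ, hτ, s₀, s, hs₀, hs, hb⟩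
    refine ⟨a ^ 2 * τ, mul_mem (pow_mem a.2 2) hτ, a ^ 2 * s₀, fun i ↦ a ^ 2 * s i,
      hs₀.sq_mul a.2, fun i ↦ (hs i).sq_mul a.2, ?_⟩
    simp only [Subalgebra.coe_mul, Subalgebra.coe_pow, hb, mul_add, Finset.mul_sum]
    congr 1
    · ring
    · congr 1
      exact Finset.sum_congr rfl fun i _ ↦ by ring

/-- A real point of `ℝ[V]` is the evaluation at a point, here extended by `0` outside `V`. -/
theorem exists_eval_eq_algHom (φ : supported ℝ V →ₐ[ℝ] ℝ) :
    ∃ z : σ → ℝ, (∀ v ∉ V, z v = 0) ∧ ∀ q : supported ℝ V, φ q = eval z (q : MvPolynomial σ ℝ) := by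
  classical
  let e := supportedEquivMvPolynomial (R := ℝ) V
  let z : σ → ℝ := fun v ↦ if h : v ∈ V then φ (e.symm (X ⟨v, h⟩)) else 0
  refine ⟨z, fun v hv ↦ dif_neg hv, fun q ↦ ?_⟩
  have key : φ.comp e.symm.toAlgHom
      = ((aeval z : MvPolynomial σ ℝ →ₐ[ℝ] ℝ).comp (supported ℝ V).val).comp e.symm.toAlgHom := by
    refine algHom_ext fun i ↦ ?_
    change φ (e.symm (X i)) = aeval z ((e.symm (X i) : supported ℝ V) : MvPolynomial σ ℝ)
    rw [supportedEquivMvPolynomial_symm_X, aeval_X]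
    simp [z, e]
  have := DFunLike.congr_fun key (e q)
  change φ (e.symm (e q)) = aeval z ((e.symm (e q) : supported ℝ V) : MvPolynomial σ ℝ) at this
  rwa [e.symm_apply_apply, aeval_eq_eval] at this

/-- Putinar's Positivstellensatz in `ℝ[S]`, in which the equation of the unit sphere makes the
quadratic module Archimedean. -/
theorem exists_eq_sphere_mul_add_of_pos (S : Finset σ) {g : ι → MvPolynomial σ ℝ}
    (hg : ∀ i, g i ∈ supported ℝ (S : Set σ)) {f : MvPolynomial σ ℝ}
    (hf : f ∈ supported ℝ (S : Set σ))
    (hpos : ∀ z : σ → ℝ, (∀ v ∉ S, z v = 0) → ∑ v ∈ S, z v ^ 2 = 1 →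
      (∀ i, 0 ≤ eval z (g i)) → 0 < eval z f) :
    ∃ τ ∈ supported ℝ (S : Set σ), ∃ (s₀ : MvPolynomial σ ℝ) (s : ι → MvPolynomial σ ℝ),
      IsSOSIn (S : Set σ) s₀ ∧ (∀ i, IsSOSIn (S : Set σ) (s i)) ∧
        f = (∑ v ∈ S, X v ^ 2 - 1) * τ + (s₀ + ∑ i, g i * s i) := by
  classical
  have hX : ∀ v ∈ S, (X v : MvPolynomial σ ℝ) ∈ supported ℝ (S : Set σ) := fun v hv ↦
    X_mem_supported.2 hv
  have hh : (∑ v ∈ S, X v ^ 2 - 1 : MvPolynomial σ ℝ) ∈ supported ℝ (S : Set σ) :=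
    sub_mem (sum_mem fun v hv ↦ pow_mem (hX v hv) 2) (one_mem _)
  set h : MvPolynomial σ ℝ := ∑ v ∈ S, X v ^ 2 - 1 with hdef
  have hM := isQuadraticModule_idealAddQM (S : Set σ) h g
  have hbdd : ∀ a : supported ℝ (S : Set σ), a ∈ hM.boundedSubalgebra := by
    have hle : supported ℝ (S : Set σ) ≤
        hM.boundedSubalgebra.map (supported ℝ (S : Set σ)).val := by
      refine Algebra.adjoin_le ?_
      rintro _ ⟨v, hv, rfl⟩
      refine ⟨⟨X v, hX v hv⟩, hM.mem_boundedSubalgebra_of_one_sub_sq_mem ?_, rfl⟩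
      -- `1 - X_v²` is `-h` plus the squares of the other variables.
      refine ⟨-1, neg_mem (one_mem _), ∑ w ∈ S.erase v, X w ^ 2, fun _ ↦ 0,
        IsSOSIn.sum _ fun w hw ↦ IsSOSIn.sq (hX w (Finset.mem_of_mem_erase hw)),
        fun _ ↦ IsSOSIn.zero, ?_⟩
      have := Finset.add_sum_erase S (fun w ↦ (X w : MvPolynomial σ ℝ) ^ 2) hv
      simp only [Subalgebra.coe_sub, Subalgebra.coe_one, Subalgebra.coe_pow, mul_zero,
        Finset.sum_const_zero, add_zero, hdef]
      linear_combination -this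
    intro a
    obtain ⟨b, hb, e⟩ := hle a.2
    rwa [← Subtype.ext (show (b : MvPolynomial σ ℝ) = a from e)]
  refine hM.mem_of_forall_algHom_pos (fun a ↦ ?_) ⟨f, hf⟩ fun φ hφ ↦ ?_
  · obtain ⟨r, -, hr, -⟩ := hbdd a
    exact ⟨r, hr⟩
  obtain ⟨z, hz, hev⟩ := exists_eval_eq_algHom φ
  rw [hev]
  refine hpos z hz ?_ fun i ↦ ?_
  · have h₁ : 0 ≤ eval z h := by
      rw [← hev ⟨h, hh⟩]
      exact hφ _ ⟨1, one_mem _, 0, fun _ ↦ 0, IsSOSIn.zero, fun _ ↦ IsSOSIn.zero, by simp⟩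
    have h₂ : 0 ≤ eval z (-h) := by
      rw [← hev ⟨-h, neg_mem hh⟩]
      exact hφ _ ⟨-1, neg_mem (one_mem _), 0, fun _ ↦ 0, IsSOSIn.zero, fun _ ↦ IsSOSIn.zero,
        by simp⟩
    simp only [hdef, map_neg, map_sub, map_sum, map_pow, eval_X, map_one] at h₁ h₂
    linarith
  · rw [← hev ⟨g i, hg i⟩]
    refine hφ _ ⟨0, zero_mem _, 0, Pi.single i 1, IsSOSIn.zero, fun j ↦ ?_, ?_⟩
    · rcases eq_or_ne j i with rfl | hj
      · simpa using IsSOSIn.one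
      · simpa [hj] using IsSOSIn.zero
    · simp [Pi.single_apply]

end Putinar

/-! ### Convergence of the hierarchy -/

section Convergence

variable {n m p : ℕ}

theorem mem_sparseSet_iff {g : Fin m → MvPolynomial (Fin n) ℝ} {I : Fin p → Finset (Fin n)}
    (J : Fin m → Fin p) (hp : 0 < p) {z : Fin (n + 1) ⊕ Fin p → ℝ} :
    z ∈ sparseSet g I ↔ ∀ ℓ, ∑ v ∈ extCliqueFinset I ℓ, z v ^ 2 = 1 ∧
      ∀ i, 0 ≤ eval z (blockConstraints g J ℓ i) := by
  simp only [sum_extCliqueFinset]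
  constructor
  · rintro ⟨h₀, h₁, h₂⟩ ℓ
    refine ⟨h₂ ℓ, ?_⟩
    rintro (_ | j)
    · simpa [blockConstraints] using h₀
    · exact h₁ j
  · intro h
    refine ⟨?_, fun j ↦ (h (J j)).2 (some ⟨j, rfl⟩), fun ℓ ↦ (h ℓ).1⟩
    simpa [blockConstraints] using (h ⟨0, hp⟩).2 none

theorem eval_nonneg_of_mem_sosCone {c k : ℕ} {g : Fin m → MvPolynomial (Fin n) ℝ}
    {I : Fin p → Finset (Fin n)} {J : Fin m → Fin p} {q : MvPolynomial (Fin (n + 1) ⊕ Fin p) ℝ}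
    (hq : q ∈ sosCone c g I J k) {z : Fin (n + 1) ⊕ Fin p → ℝ} (hz : z ∈ sparseSet g I) :
    0 ≤ eval z q := by
  obtain ⟨a, b, ha, hb, rfl⟩ := hq
  rw [map_sum]
  refine Finset.sum_nonneg fun ℓ _ ↦ ?_
  have hℓ := (mem_sparseSet_iff J ℓ.pos).1 hz ℓ
  obtain ⟨τ, -, -, e⟩ := ha ℓ
  obtain ⟨s₀, s, hs₀, -, hs, e'⟩ := hb ℓ
  have h0 : eval z (sphere I ℓ) = 0 := by
    simp [sphere_eq, hℓ.1]
  rw [map_add, e, e', map_mul, h0, zero_mul, zero_add, map_add, map_sum]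
  refine add_nonneg (hs₀.eval_nonneg z) (Finset.sum_nonneg fun i _ ↦ ?_)
  rw [map_mul]
  exact mul_nonneg (hℓ.2 i) ((hs i).1.eval_nonneg z)

theorem sosValue_le_pertValue (c : ℕ) (f : MvPolynomial (Fin n) ℝ)
    (g : Fin m → MvPolynomial (Fin n) ℝ) (I : Fin p → Finset (Fin n)) (J : Fin m → Fin p) (ε : ℝ)
    (k : ℕ) : sosValue c f g I J ε k ≤ pertValue f g I ε :=
  biSup_mono fun _ hγ _ hz ↦ eval_nonneg_of_mem_sosCone hγ hz

theorem eventually_degLE {σ : Type*} (q : MvPolynomial σ ℝ) (e : ℕ) :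
    ∀ᶠ k : ℕ in atTop, DegLE q e (2 * k) := by
  filter_upwards [eventually_ge_atTop (q.totalDegree + e)] with k hk
  exact Or.inr (by omega)

theorem blockConstraints_mem_supported {f : MvPolynomial (Fin n) ℝ}
    {g : Fin m → MvPolynomial (Fin n) ℝ} {I : Fin p → Finset (Fin n)} {J : Fin m → Fin p}
    (hcsp : IsCSP f g I J) (ℓ : Fin p) (i : Option {j // J j = ℓ}) :
    blockConstraints g J ℓ i ∈ supported ℝ (extClique I ℓ) := by
  rcases i with _ | ⟨j, rfl⟩
  · exact X_inl_zero_mem_supported I ℓ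
  · exact homogExt_mem_supported I _ (hcsp.constraints j)

/-- The sparse Positivstellensatz: the splitting of a positive sparse polynomial into positive
summands reduces it to Putinar's theorem for the individual blocks of variables. -/
theorem eventually_mem_sosCone_of_pos (c : ℕ) {f : MvPolynomial (Fin n) ℝ}
    {g : Fin m → MvPolynomial (Fin n) ℝ} {I : Fin p → Finset (Fin n)} {J : Fin m → Fin p}
    (hcsp : IsCSP f g I J) (hrip : RunningIntersection I) (hp : 0 < p)
    {F : Fin p → MvPolynomial (Fin (n + 1) ⊕ Fin p) ℝ}
    (hF : ∀ ℓ, F ℓ ∈ supported ℝ (extClique I ℓ))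
    (hpos : ∀ z ∈ sparseSet g I, 0 < eval z (∑ ℓ, F ℓ)) :
    ∀ᶠ k : ℕ in atTop, ∑ ℓ, F ℓ ∈ sosCone c g I J k := by
  let B : Set (Fin (n + 1) ⊕ Fin p → ℝ) := Set.univ.pi fun _ ↦ Set.Icc (-1) 1
  have hB : IsCompact B := isCompact_univ_pi fun _ ↦ isCompact_Icc
  let K : Fin p → Set (Fin (n + 1) ⊕ Fin p → ℝ) := fun ℓ ↦
    {z | ∑ v ∈ extCliqueFinset I ℓ, z v ^ 2 = 1 ∧ ∀ i, 0 ≤ eval z (blockConstraints g J ℓ i)}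
  have hKclosed : ∀ ℓ, IsClosed (K ℓ) := fun ℓ ↦ by
    refine (isClosed_eq (by fun_prop) continuous_const).and ?_
    simp only [Set.ofPred_forall]
    exact isClosed_iInter fun i ↦ isClosed_le continuous_const (continuous_eval _)
  have hmemV : ∀ {ℓ v}, v ∈ extCliqueFinset I ℓ ↔ v ∈ extClique I ℓ := fun {ℓ v} ↦ by
    rw [← coe_extCliqueFinset, Finset.mem_coe]
  obtain ⟨H, hH, hHF, hHpos⟩ := exists_sum_eq_and_pos (b := fun _ ↦ Set.Icc (-1) 1)
    (fun ℓ ↦ extClique I ℓ) (fun ℓ ↦ B ∩ K ℓ) F hrip.extClique hF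
    (fun ℓ ↦ hB.inter_right (hKclosed ℓ)) (fun ℓ ↦ Set.inter_subset_left)
    (by
      rintro ℓ z ⟨-, hz₁, hz₂⟩ z' hz' heq
      refine ⟨hz', ?_, fun i ↦ ?_⟩
      · rw [← hz₁]
        exact Finset.sum_congr rfl fun v hv ↦ by rw [heq (hmemV.1 hv)]
      · rw [← eval_eq_of_mem_supported (blockConstraints_mem_supported hcsp ℓ i) heq]
        exact hz₂ i)
    (fun z hz ↦ hpos z ((mem_sparseSet_iff J hp).2 fun ℓ ↦ (hz ℓ).2))
  have hrep : ∀ ℓ, ∃ τ ∈ supported ℝ (extClique I ℓ),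
      ∃ (s₀ : MvPolynomial (Fin (n + 1) ⊕ Fin p) ℝ)
        (s : Option {j // J j = ℓ} → MvPolynomial (Fin (n + 1) ⊕ Fin p) ℝ),
        IsSOSIn (extClique I ℓ) s₀ ∧ (∀ i, IsSOSIn (extClique I ℓ) (s i)) ∧
        H ℓ = sphere I ℓ * τ + (s₀ + ∑ i, blockConstraints g J ℓ i * s i) := by
    intro ℓ
    have hg := blockConstraints_mem_supported hcsp ℓ
    have hHℓ := hH ℓ
    rw [sphere_eq]
    rw [← coe_extCliqueFinset] at hg hHℓ ⊢
    refine exists_eq_sphere_mul_add_of_pos _ hg hHℓ fun z hz hsum hzg ↦ ?_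
    refine hHpos ℓ z ⟨fun v _ ↦ ?_, hsum, hzg⟩
    by_cases hv : v ∈ extCliqueFinset I ℓ
    · have : z v ^ 2 ≤ 1 := hsum ▸
        Finset.single_le_sum (f := fun v ↦ z v ^ 2) (fun w _ ↦ sq_nonneg _) hv
      exact abs_le.1 (sq_le_one_iff_abs_le_one _ |>.1 this)
    · rw [hz v hv]
      exact ⟨by norm_num, by norm_num⟩
  choose τ hτ s₀ s hs₀ hs e using hrep
  have h₁ : ∀ᶠ k : ℕ in atTop, ∀ ℓ, DegLE (τ ℓ) (sphere I ℓ).totalDegree (2 * k) :=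
    eventually_all.2 fun ℓ ↦ eventually_degLE _ _
  have h₂ : ∀ᶠ k : ℕ in atTop, ∀ ℓ, DegLE (s₀ ℓ) 0 (2 * k) :=
    eventually_all.2 fun ℓ ↦ eventually_degLE _ _
  have h₃ : ∀ᶠ k : ℕ in atTop, ∀ ℓ i, DegLE (s ℓ i)
      (c * (((blockConstraints g J ℓ i).totalDegree + 1) / 2)) (2 * k) :=
    eventually_all.2 fun ℓ ↦ eventually_all.2 fun i ↦ eventually_degLE _ _
  filter_upwards [h₁, h₂, h₃] with k k₁ k₂ k₃
  refine ⟨fun ℓ ↦ sphere I ℓ * τ ℓ, fun ℓ ↦ s₀ ℓ + ∑ i, blockConstraints g J ℓ i * s ℓ i,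
    fun ℓ ↦ ⟨τ ℓ, hτ ℓ, k₁ ℓ, rfl⟩,
    fun ℓ ↦ ⟨s₀ ℓ, s ℓ, hs₀ ℓ, k₂ ℓ, fun i ↦ ⟨hs ℓ i, k₃ ℓ i⟩, rfl⟩, ?_⟩
  rw [← hHF]
  exact Finset.sum_congr rfl fun ℓ _ ↦ e ℓ

/-- Without blocks there are no variables other than `x₀`, the sphere constraints disappear, and
both optimal values equal `ε`. -/
theorem sosValue_eq_pertValue_of_isEmpty (c : ℕ) {f : MvPolynomial (Fin n) ℝ}
    {g : Fin m → MvPolynomial (Fin n) ℝ} {I : Fin 0 → Finset (Fin n)} {J : Fin m → Fin 0}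
    (hcsp : IsCSP f g I J) (ε : ℝ) (k : ℕ) :
    sosValue c f g I J ε k = pertValue f g I ε := by
  have hn : IsEmpty (Fin n) := ⟨fun i ↦ (hcsp.cover i).choose.elim0⟩
  have hm : IsEmpty (Fin m) := ⟨fun j ↦ (J j).elim0⟩
  obtain rfl : n = 0 := by
    by_contra h
    exact hn.false ⟨0, Nat.pos_of_ne_zero h⟩
  have hf : f = 0 := by
    obtain ⟨F, -, rfl⟩ := hcsp.objective
    simp
  subst hf
  refine le_antisymm (sosValue_le_pertValue c _ g I J ε k) ?_
  have hpert : ∀ γ, pertPoly 0 (0 : MvPolynomial (Fin 0) ℝ) ε γ = C (ε - γ) := by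
    intro γ
    simp [pertPoly, homogExt, homog]
  refine (iSup₂_le fun γ hγ ↦ ?_).trans (le_iSup₂_of_le ε ?_ le_rfl)
  · have := hγ 0 ⟨le_rfl, fun j ↦ isEmptyElim j, fun ℓ ↦ ℓ.elim0⟩
    rw [hpert, eval_C] at this
    exact_mod_cast sub_nonneg.1 this
  · change pertPoly 0 (0 : MvPolynomial (Fin 0) ℝ) ε ε ∈ sosCone c g I J k
    rw [hpert, sub_self, C_0]
    exact ⟨fun ℓ ↦ 0, fun ℓ ↦ 0, fun ℓ ↦ ℓ.elim0, fun ℓ ↦ ℓ.elim0, by simp⟩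

theorem tendsto_sosValue (c : ℕ) {f : MvPolynomial (Fin n) ℝ}
    {g : Fin m → MvPolynomial (Fin n) ℝ} {I : Fin p → Finset (Fin n)} {J : Fin m → Fin p}
    (hf : BddBelow ((fun x => eval x f) '' feasibleSet g)) (hK : ClosedAtInfinity g)
    (hcsp : IsCSP f g I J) (hrip : RunningIntersection I) {ε : ℝ} (hε : 0 < ε) :
    Tendsto (fun k : ℕ => sosValue c f g I J ε k) atTop (𝓝 (pertValue f g I ε)) := by
  rcases Nat.eq_zero_or_pos p with rfl | hp
  · simp only [sosValue_eq_pertValue_of_isEmpty c hcsp]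
    exact tendsto_const_nhds
  refine tendsto_order.2 ⟨fun a ha ↦ ?_, fun a ha ↦
    Eventually.of_forall fun k ↦ (sosValue_le_pertValue c f g I J ε k).trans_lt ha⟩
  obtain ⟨γ', hγ', haγ'⟩ := lt_biSup_iff.1 ha
  obtain ⟨γ, haγ, hγ⟩ := EReal.lt_iff_exists_real_btwn.1 haγ'
  obtain ⟨F, hF, e⟩ := exists_pertPoly_eq_sum hcsp hp ε γ
  have hpos := eval_pertPoly_pos hf hK hp hε (EReal.coe_lt_coe_iff.1 hγ) hγ'
  rw [e] at hpos
  filter_upwards [eventually_mem_sosCone_of_pos c hcsp hrip hp hF hpos] with k hk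
  rw [← e] at hk
  exact haγ.trans_le (le_iSup₂_of_le γ hk le_rfl)

end Convergence

end SparsePOP

theorem mainTheorem1 {n m p : ℕ} (f : MvPolynomial (Fin n) ℝ)
    (g : Fin m → MvPolynomial (Fin n) ℝ) (I : Fin p → Finset (Fin n)) (J : Fin m → Fin p)
    (hf : BddBelow ((fun x => eval x f) '' feasibleSet g))
    (hK : ClosedAtInfinity g) (hcsp : IsCSP f g I J) (hrip : RunningIntersection I)
    (ε : ℝ) (hε : 0 < ε) :
    Tendsto (fun k : ℕ => sosValue 1 f g I J ε k) atTop (𝓝 (pertValue f g I ε)) ∧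
    Tendsto (fun k : ℕ => sosValue 2 f g I J ε k) atTop (𝓝 (pertValue f g I ε)) :=
  ⟨tendsto_sosValue 1 hf hK hcsp hrip hε, tendsto_sosValue 2 hf hK hcsp hrip hε⟩
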